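/- Let $k$ be an algebraically closed field, $X$ a smooth proper curve over $k$ (curves are connected, equivalently integral), and $G$ a finite group. A \emph{branched cover} with source $X$ is a finite, generically \'etale $k$-morphism $f:X\to Y$ to a smooth proper curve $Y$ over $k$. It is \emph{$G$-Galois} if the group $\operatorname{Aut}(X/Y)=\{\sigma\in\operatorname{Aut}_k(X): f\circ\sigma=f\}$ has order $\deg f=[\kappa(X):\kappa(Y)]$ and is isomorphic to $G$. Two branched covers $f_i:X\to Y_i$ ($i=1,2$) are \emph{equivalent} if there is a $k$-isomorphism $\varphi:Y_1\to Y_2$ with $\varphi\circ f_1=f_2$. A \emph{$G$-action} on $X$ is a subgroup $H\subseteq\operatorname{Aut}_k(X)$ isomorphic to $G$. Then $(f:X\to Y)\mapsto \operatorname{Aut}(X/Y)$ induces a well-defined bijection from the set of equivalence classes of $G$-Galois branched covers with source $X$ to the set of $G$-actions on $X$. Moreover, under this correspondence the ramification points of a $G$-Galois branched cover $f:X\to Y$ (the closed points of $X$ at which $f$ is not unramified) are exactly the stabilized points of the corresponding $G$-action $H=\operatorname{Aut}(X/Y)$, i.e. the closed points of $X$ whose stabilizer in $H$ is nontrivial.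 -/

import Mathlib

open CategoryTheory AlgebraicGeometry

universe u

namespace CurveCovers

variable {k : Type u} [Field k]

/-- A smooth proper curve over the field `k`: an integral scheme, proper over `k` and smooth over
`k` of relative dimension `1`. (For schemes smooth over a field, integral and connected are the
same.) -/
class IsSmoothProperCurve (X : Over (Spec (.of k))) : Prop where
  isIntegral : IsIntegral X.left
  isProper : IsProper X.hom
  smooth : SmoothOfRelativeDimension 1 X.hom

attribute [instance] IsSmoothProperCurve.isIntegral IsSmoothProperCurve.isProper
  IsSmoothProperCurve.smooth

/-- A morphism of schemes with irreducible source is generically étale if it is étale on some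
nonempty (equivalently, dense) open subscheme of the source. -/
def GenericallyEtale {X Y : Scheme.{u}} (f : X ⟶ Y) : Prop :=
  ∃ U : X.Opens, (U : Set X).Nonempty ∧ Etale (U.ι ≫ f)

/-- A branched cover of smooth proper curves: a finite, generically étale `k`-morphism. -/
structure IsBranchedCover {X Y : Over (Spec (.of k))} (f : X ⟶ Y) : Prop where
  isFinite : IsFinite f.left
  genericallyEtale : GenericallyEtale f.left

/-- The degree of a morphism `f : X ⟶ Y` of integral schemes. For dominant `f`, the image
`f (genericPoint X)` is the generic point of `Y`, so the stalk of `Y` there is the function field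
of `Y`, and this is the degree `[κ(X) : κ(Y)]` of the extension of function fields. -/
noncomputable def degree {X Y : Scheme.{u}} [IsIntegral X] (f : X ⟶ Y) : ℕ :=
  letI : Algebra (Y.presheaf.stalk (f (genericPoint X))) X.functionField :=
    (f.stalkMap (genericPoint X)).hom.toAlgebra
  Module.finrank (Y.presheaf.stalk (f (genericPoint X))) X.functionField

/-- `Aut(X/Y)`: the group of `k`-automorphisms of `X` commuting with `f : X ⟶ Y`. -/
def autOver {X Y : Over (Spec (.of k))} (f : X ⟶ Y) : Subgroup (Aut X) where
  carrier := {σ | σ.hom ≫ f = f}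
  one_mem' := Category.id_comp f
  mul_mem' {σ τ} hσ hτ := by
    change (τ.hom ≫ σ.hom) ≫ f = f
    rw [Category.assoc, show σ.hom ≫ f = f from hσ, show τ.hom ≫ f = f from hτ]
  inv_mem' {σ} hσ := by
    exact (Iso.inv_comp_eq (show X ≅ X from σ)).2 (show σ.hom ≫ f = f from hσ).symm

/-- A `G`-Galois branched cover with source `X`. The target is a smooth proper curve that is part
of the data. The cover is Galois: the order of `Aut(X/Y)` is the degree. And it is `G`-Galois:
`Aut(X/Y)` is isomorphic to `G`. -/
structure GaloisCover (X : Over (Spec (.of k))) [IsSmoothProperCurve X]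
    (G : Type*) [Group G] where
  target : Over (Spec (.of k))
  target_isCurve : IsSmoothProperCurve target
  map : X ⟶ target
  isBranchedCover : IsBranchedCover map
  card_aut_eq_degree : Nat.card (autOver map) = degree map.left
  aut_iso : Nonempty (autOver map ≃* G)

/-- Two covers `f₁ : X ⟶ Y₁` and `f₂ : X ⟶ Y₂` with the same source are equivalent if there is
an isomorphism `φ : Y₁ ≅ Y₂` over `k` with `φ ∘ f₁ = f₂`. -/
instance coverSetoid (X : Over (Spec (.of k))) [IsSmoothProperCurve X]
    (G : Type*) [Group G] : Setoid (GaloisCover X G) where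
  r c₁ c₂ := ∃ φ : c₁.target ≅ c₂.target, c₁.map ≫ φ.hom = c₂.map
  iseqv :=
    { refl := fun c => ⟨Iso.refl _, Category.comp_id _⟩
      symm := by
        rintro c₁ c₂ ⟨φ, h⟩
        exact ⟨φ.symm, by rw [← h, Category.assoc, Iso.symm_hom, Iso.hom_inv_id, Category.comp_id]⟩
      trans := by
        rintro c₁ c₂ c₃ ⟨φ, h⟩ ⟨ψ, h'⟩
        exact ⟨φ.trans ψ, by rw [Iso.trans_hom, ← Category.assoc, h, h']⟩ }

/-- Equivalence classes of `G`-Galois branched covers with source `X`. -/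
abbrev CoverClass (X : Over (Spec (.of k))) [IsSmoothProperCurve X]
    (G : Type*) [Group G] : Type _ :=
  Quotient (coverSetoid X G)

/-- A `G`-action on `X`: a subgroup of `Aut(X)` that is isomorphic to `G`. -/
abbrev GroupAction (X : Over (Spec (.of k))) (G : Type*) [Group G] : Type _ :=
  {H : Subgroup (Aut X) // Nonempty (H ≃* G)}

/-- The action of `Aut(X)` on the points of `X`. -/
noncomputable instance autMulAction (X : Over (Spec (.of k))) : MulAction (Aut X) X.left where
  smul σ x := σ.hom.left x
  one_smul _ := rfl
  mul_smul _ _ _ := rfl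

/-- The stabilized locus of a subgroup `H` of `Aut(X)`: the closed points whose stabilizer in `H`
is nontrivial. -/
def stabilizedLocus {X : Over (Spec (.of k))} (H : Subgroup (Aut X)) : Set X.left :=
  {x | IsClosed {x} ∧ MulAction.stabilizer H x ≠ ⊥}

/-- The ramification locus of `f : X ⟶ Y`: the closed points `x` at which `f` is not unramified,
that is, at which `Ω` of the local homomorphism `𝒪_{Y, f x} → 𝒪_{X, x}` does not vanish. -/
def ramificationLocus {X Y : Scheme.{u}} (f : X ⟶ Y) : Set X :=
  {x | IsClosed {x} ∧ ¬ (f.stalkMap x).hom.FormallyUnramified}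

end CurveCovers

/-! ### Commutative algebra of smooth affine curves -/

/-! The inverse of `f ↦ Aut(X/Y)` sends `H` to the quotient `X → X/H`. Three things are needed: a
Galois cover is the quotient by its group, quotients exist as smooth proper curves with the right
automorphism group, and ramification is seen by stabilizers.

A Galois cover is a quotient. Over a nonempty affine open `W` of `Y`, the group `Aut(X/Y)` acts
faithfully on the sections over the preimage, its order is the rank of the extension, and the ring
of `W` is integrally closed, so this ring is exactly the ring of invariants
(`IsGaloisGroup.of_card_eq_finrank`, `isGaloisGroup_sections`). Hence every invariant morphism `g`
from `X` to a proper scheme `Z` factors through `Y` (`exists_comp_eq_of_invariant`): the image of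
`(f, g)` in the product is finite over `Y`, and invariance of sections makes its projection to `Y`
an isomorphism. Covers with the same group therefore factor through each other.

Quotients exist. A stable affine open has a coordinate ring integral over its invariants, so some
invariant rational function `t` is nonconstant. Since the local rings are valuation rings, the loci
where `t` and `t⁻¹` are regular cover `X`. Each locus is stable, and it is affine because it is
finite over the affine line: it has finite fibres, and the valuative criterion gives closedness
(`isAffineOpen_of_sup_eq_top`). The overlap is a basic open set of both, invariants commute with
this localization, and the spectra of the two invariant rings glue to `Y` (`exists_quotient`). The
invariant rings are finitely generated by Artin–Tate and Dedekind, hence smooth over an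
algebraically closed field; properness descends along `X → Y`. Galois theory on one chart gives
`Aut(X/Y) = H` and the degree (`exists_galoisCover`).

Ramification. At a closed point the residue fields are `k`, so the stabilizer has order `e f = e`,
and being unramified means `e = 1`. -/

theorem MvPolynomial.isPrincipalIdealRing_fin_one (k : Type*) [Field k] :
    IsPrincipalIdealRing (MvPolynomial (Fin 1) k) :=
  .of_surjective (MvPolynomial.uniqueAlgEquiv k (Fin 1)).symm.toRingEquiv.toRingHom
    (MvPolynomial.uniqueAlgEquiv k (Fin 1)).symm.surjective

/-- A domain étale over a principal ideal domain is a Dedekind domain. -/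
theorem IsDedekindDomain.of_etale_of_isPrincipalIdealRing (S R : Type*) [CommRing S] [IsDomain S]
    [IsPrincipalIdealRing S] [CommRing R] [IsDomain R] [Algebra S R] [Algebra.Etale S R] :
    IsDedekindDomain R := by
  have : IsNoetherianRing R := Algebra.FiniteType.isNoetherianRing S R
  have : IsDedekindDomainDvr R :=
    { is_dvr_at_nonzero_prime := fun q hq _ ↦ by
        -- Unramifiedness says that the contraction of `q` generates the maximal ideal of the local
        -- ring at `q`; being principal, it supplies a uniformizer.
        let p := q.under S
        let := Localization.AtPrime.algebraOfLiesOver p q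
        have h := ((Algebra.isUnramifiedAt_iff_map_eq S p q).mp
          (Algebra.FormallyUnramified.comp S R _)).2
        refine ((IsDiscreteValuationRing.TFAE (Localization.AtPrime q)
          (IsLocalization.AtPrime.not_isField R hq (Localization.AtPrime q))).out 4 0).mp ?_
        rw [← h, ← Ideal.span_singleton_generator p, Ideal.map_span, Set.image_singleton]
        exact ⟨_, rfl⟩ }
  infer_instance

theorem IsDedekindDomain.of_isStandardSmoothOfRelativeDimension_one (k R : Type*) [Field k]
    [CommRing R] [Algebra k R] [Algebra.IsStandardSmoothOfRelativeDimension 1 k R] [IsDomain R] :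
    IsDedekindDomain R := by
  obtain ⟨g, hg⟩ := Algebra.IsStandardSmoothOfRelativeDimension.exists_etale_mvPolynomial 1 k R
  let := g.toRingHom.toAlgebra
  have : Algebra.Etale (MvPolynomial (Fin 1) k) R := hg
  have := MvPolynomial.isPrincipalIdealRing_fin_one k
  exact .of_etale_of_isPrincipalIdealRing (MvPolynomial (Fin 1) k) R

/-- The ring is étale, hence flat, over a polynomial ring in one variable, which therefore embeds in
it; the variable is not a constant. -/
theorem Algebra.IsStandardSmoothOfRelativeDimension.not_surjective_algebraMap (k R : Type*)
    [Field k] [CommRing R] [Algebra k R] [Algebra.IsStandardSmoothOfRelativeDimension 1 k R]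
    [Nontrivial R] : ¬ Function.Surjective (algebraMap k R) := by
  obtain ⟨g, hg⟩ := Algebra.IsStandardSmoothOfRelativeDimension.exists_etale_mvPolynomial 1 k R
  let := g.toRingHom.toAlgebra
  have : Algebra.Etale (MvPolynomial (Fin 1) k) R := hg
  have hinj : Function.Injective g :=
    FaithfulSMul.algebraMap_injective (MvPolynomial (Fin 1) k) R
  intro h
  obtain ⟨c, hc⟩ := h (g (.X 0))
  have := hinj (hc.symm.trans (g.commutes c).symm)
  have := congr(MvPolynomial.totalDegree $this)
  simp at this

open Polynomial in
instance Polynomial.isStandardSmoothOfRelativeDimension_one (k : Type*) [Field k] :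
    Algebra.IsStandardSmoothOfRelativeDimension 1 k k[X] := by
  have : Algebra.IsStandardSmooth k k[X] :=
    .of_basis_kaehlerDifferential
      ((Module.Basis.singleton Unit k[X]).map (KaehlerDifferential.polynomialEquiv k).symm) (by
        rintro _ ⟨i, rfl⟩
        exact ⟨X, by simp [KaehlerDifferential.polynomialEquiv_symm]⟩)
  rw [Algebra.IsStandardSmoothOfRelativeDimension.iff_of_isStandardSmooth,
    (KaehlerDifferential.polynomialEquiv k).rank_eq]
  simp

theorem IsIntegral.exists_algebraMap_eq_of_isAlgClosed {k A : Type*} [Field k] [IsAlgClosed k]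
    [CommRing A] [IsDomain A] [Algebra k A] {t : A} (ht : IsIntegral k t) :
    ∃ c, algebraMap k A c = t := by
  obtain ⟨c, hc⟩ := (IsAlgClosed.algebraMap_bijective_of_isIntegral
    (k := k) (K := integralClosure k A)).2 ⟨t, ht⟩
  exact ⟨c, congr_arg Subtype.val hc⟩

open Polynomial in
/-- A finitely generated Dedekind domain over an algebraically closed field `k`, other than `k`
itself, is locally standard smooth of relative dimension one. -/
theorem IsDedekindDomain.exists_isStandardSmoothOfRelativeDimension_one (k A : Type*) [Field k]
    [IsAlgClosed k] [CommRing A] [Algebra k A] [Algebra.FiniteType k A]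
    [IsDedekindDomain A] (hA : ¬ Function.Surjective (algebraMap k A)) (P : Ideal A) [P.IsPrime] :
    ∃ f ∉ P, Algebra.IsStandardSmoothOfRelativeDimension 1 k (Localization.Away f) := by
  -- Avoiding a larger ideal is stronger, so `P` may be replaced by a maximal ideal `m`. It is
  -- nonzero, since otherwise `A` would be a finite field extension of `k`, hence `k`.
  obtain ⟨m, hm, hPm⟩ := Ideal.exists_le_maximal P ‹P.IsPrime›.ne_top
  have hm0 : m ≠ ⊥ := by
    rintro rfl
    let := (Ring.isField_iff_maximal_bot.mpr hm).toField
    have : Module.Finite k A := finite_of_finite_type_of_isJacobsonRing k A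
    exact hA (IsAlgClosed.algebraMap_bijective_of_isIntegral).2
  have := IsLocalization.AtPrime.isDiscreteValuationRing_of_dedekind_domain A hm0
    (Localization.AtPrime m)
  obtain ⟨ϖ, hϖ⟩ := IsDiscreteValuationRing.exists_irreducible (Localization.AtPrime m)
  obtain ⟨t, s, rfl⟩ := IsLocalization.exists_mk'_eq m.primeCompl ϖ
  have hspan : IsLocalRing.maximalIdeal (Localization.AtPrime m) =
      Ideal.span {algebraMap A (Localization.AtPrime m) t} := by
    rw [(IsDiscreteValuationRing.irreducible_iff_uniformizer _).mp hϖ]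
    refine Ideal.span_singleton_eq_span_singleton.mpr ?_
    refine ⟨(IsLocalization.map_units (Localization.AtPrime m) s).unit, ?_⟩
    simp
  have ht : t ∈ m := by
    rw [← IsLocalization.AtPrime.to_map_mem_maximal_iff (Localization.AtPrime m) m, hspan]
    exact Ideal.mem_span_singleton_self _
  have ht0 : t ≠ 0 := by
    rintro rfl
    exact IsDiscreteValuationRing.not_a_field (Localization.AtPrime m) (by simpa using hspan)
  -- Sending `X` to a uniformizer `t` at `m` makes `A` étale over `k[X]` at `m`: it is torsion-free,
  -- hence flat, and it is unramified because `t` generates the maximal ideal and the residue field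
  -- is finite over `k`.
  let : Algebra k[X] A := (aeval t).toAlgebra
  have hX : algebraMap k[X] A X = t := aeval_X t
  have : IsScalarTower k k[X] A := .of_algebraMap_eq' (aeval t).comp_algebraMap.symm
  have hinj : Function.Injective (algebraMap k[X] A) := by
    change Function.Injective (aeval t)
    rw [← transcendental_iff_injective]
    -- An algebraic `t` would be a nonzero constant, a unit lying in `m`.
    intro hint
    have : IsIntegral k t := hint.isIntegral
    obtain ⟨c, rfl⟩ := this.exists_algebraMap_eq_of_isAlgClosed
    have hc : c ≠ 0 := by rintro rfl; simp at ht0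
    exact hm.ne_top (Ideal.eq_top_of_isUnit_mem _ ht ((IsUnit.mk0 c hc).map _))
  have : FaithfulSMul k[X] A := (faithfulSMul_iff_algebraMap_injective _ _).mpr hinj
  have : Algebra.FiniteType k[X] A := .of_restrictScalars_finiteType k k[X] A
  have : Algebra.FinitePresentation k[X] A := Algebra.FinitePresentation.of_finiteType.mp inferInstance
  have : Module.IsTorsionFree k[X] A := inferInstance
  have : Module.Flat k[X] A := inferInstance
  have : Algebra.IsUnramifiedAt k[X] m := by
    let q := m.under k[X]
    let := Localization.AtPrime.algebraOfLiesOver q m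
    rw [Algebra.isUnramifiedAt_iff_map_eq k[X] q m]
    constructor
    · have : Module.Finite k (A ⧸ m) := by
        let := Ideal.Quotient.field m
        exact finite_of_finite_type_of_isJacobsonRing k (A ⧸ m)
      have : Module.Finite k m.ResidueField :=
        .of_surjective (IsScalarTower.toAlgHom k (A ⧸ m) m.ResidueField).toLinearMap
          m.bijective_algebraMap_quotient_residueField.2
      have : Algebra.IsSeparable k m.ResidueField := inferInstance
      exact Algebra.isSeparable_tower_top_of_isSeparable k _ _
    · apply le_antisymm
      · rw [Ideal.map_le_iff_le_comap]
        intro x hx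
        rw [Ideal.mem_comap, IsScalarTower.algebraMap_apply k[X] A,
          IsLocalization.AtPrime.to_map_mem_maximal_iff _ m]
        exact hx
      · rw [hspan, Ideal.span_singleton_le_iff_mem, ← hX, ← IsScalarTower.algebraMap_apply]
        exact Ideal.mem_map_of_mem _ (show algebraMap k[X] A X ∈ m by rwa [hX])
  have := Algebra.IsEtaleAt.of_isUnramifiedAt_of_flat (R := k[X]) m
  obtain ⟨f, hf, _⟩ := Algebra.exists_etale_of_isEtaleAt (R := k[X]) m
  refine ⟨f, fun h ↦ hf (hPm h), ?_⟩
  have : Algebra.IsStandardSmoothOfRelativeDimension 0 k[X] (Localization.Away f) :=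
    Algebra.Etale.iff_isStandardSmoothOfRelativeDimension_zero.mp inferInstance
  exact Algebra.IsStandardSmoothOfRelativeDimension.trans 1 0 k k[X] (Localization.Away f)

theorem IsGaloisGroup.module_finite (k A B H : Type*) [Field k] [CommRing A] [CommRing B]
    [Algebra k A] [Algebra k B] [Algebra A B] [IsScalarTower k A B] [Group H] [Finite H]
    [MulSemiringAction H B] [IsGaloisGroup H A B]
    [Algebra.FiniteType k B] :
    Module.Finite A B := by
  have : Algebra.FiniteType A B := .of_restrictScalars_finiteType k A B
  have : Algebra.IsIntegral A B := Algebra.IsInvariant.isIntegral A B H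
  exact Algebra.IsIntegral.finite

/-- This is the Artin–Tate lemma: `B` is finite over `A` and of finite type over `k`. -/
theorem IsGaloisGroup.finiteType_of_finiteType (k A B H : Type*) [Field k] [CommRing A] [CommRing B]
    [Algebra k A] [Algebra k B] [Algebra A B] [IsScalarTower k A B] [Group H] [Finite H]
    [MulSemiringAction H B] [IsGaloisGroup H A B]
    [FaithfulSMul A B] [Algebra.FiniteType k B] :
    Algebra.FiniteType k A := by
  have := IsGaloisGroup.module_finite k A B H
  exact ⟨fg_of_fg_of_fg k A B Algebra.FiniteType.out Module.Finite.fg_top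
    (FaithfulSMul.algebraMap_injective A B)⟩

/-- Dimension at most one descends by lying over. For normality, a fraction of `A` integral over `A`
lies in `B`, where it is fixed by `H`, hence lies in `A`. -/
theorem IsGaloisGroup.isDedekindDomain (k A B H : Type*) [Field k] [CommRing A] [CommRing B]
    [Algebra k A] [Algebra k B] [Algebra A B] [IsScalarTower k A B] [Group H] [Finite H]
    [MulSemiringAction H B] [IsGaloisGroup H A B]
    [FaithfulSMul A B] [Algebra.FiniteType k B]
    [IsDedekindDomain B] : IsDedekindDomain A := by
  have hinj := FaithfulSMul.algebraMap_injective A B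
  have : IsDomain A := hinj.isDomain
  have := IsGaloisGroup.finiteType_of_finiteType k A B H
  have : IsNoetherianRing A := Algebra.FiniteType.isNoetherianRing k A
  have : Algebra.IsIntegral A B := Algebra.IsInvariant.isIntegral A B H
  have : Ring.DimensionLEOne A := ⟨fun {p} hp _ ↦ by
    obtain ⟨Q, -, hQ, rfl⟩ := Ideal.exists_ideal_over_prime_of_isIntegral (S := B) p ⊥ (by
      rw [Ideal.comap_bot_of_injective _ hinj]; exact bot_le)
    have hQ0 : Q ≠ ⊥ := by
      rintro rfl
      exact hp (Ideal.comap_bot_of_injective _ hinj)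
    have := hQ.isMaximal hQ0
    exact Ideal.isMaximal_comap_of_isIntegral_of_isMaximal Q⟩
  have : IsIntegrallyClosed A := by
    refine (isIntegrallyClosed_iff (FractionRing A)).mpr fun {x} hx ↦ ?_
    obtain ⟨a, s, hs, rfl⟩ := IsFractionRing.div_surjective A x
    have hs0 : s ≠ 0 := nonZeroDivisors.ne_zero hs
    let φ : FractionRing A →+* FractionRing B :=
      IsFractionRing.map (K := FractionRing A) (L := FractionRing B) hinj
    have hφ (a : A) : φ (algebraMap A _ a) = algebraMap B _ (algebraMap A B a) :=
      IsLocalization.map_eq _ a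
    have hx' : IsIntegral B (φ (algebraMap A _ a / algebraMap A _ s)) := by
      refine (hx.map_of_comp_eq (algebraMap A B) φ ?_)
      ext; simp [hφ]
    obtain ⟨b, hb⟩ := IsIntegrallyClosed.isIntegral_iff.mp hx'
    have hbs : b * algebraMap A B s = algebraMap A B a := by
      apply IsFractionRing.injective B (FractionRing B)
      rw [map_mul, hb, ← hφ, ← hφ, ← map_mul, div_mul_cancel₀]
      simpa using hs0
    obtain ⟨c, rfl⟩ := Algebra.IsInvariant.isInvariant (A := A) (G := H) b fun g ↦ by
      have h1 := congr(g • $hbs)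
      rw [smul_mul', smul_algebraMap, smul_algebraMap, ← hbs] at h1
      exact mul_right_cancel₀ (by simpa using hs0) h1
    refine ⟨c, ?_⟩
    rw [eq_div_iff (by simpa using hs0), ← map_mul]
    congr 1
    exact hinj (by rw [map_mul, hbs])
  exact {}

theorem IsGaloisGroup.card_eq_finrank_of_isDomain (A B H : Type*) [CommRing A] [CommRing B]
    [IsDomain A] [IsDomain B] [Algebra A B] [FaithfulSMul A B] [Group H] [Finite H]
    [MulSemiringAction H B] [IsGaloisGroup H A B] :
    Nat.card H = Module.finrank A B := by
  let := FractionRing.liftAlgebra A (FractionRing B)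
  let := IsFractionRing.mulSemiringAction H B (FractionRing B)
  rw [IsGaloisGroup.card_eq_finrank H (FractionRing A) (FractionRing B),
    IsFractionRing.finrank_eq A (FractionRing A) B (FractionRing B)]

/-- A finite group acting faithfully on a finite extension of degree at most its order, with
integrally closed base, is the Galois group of the extension. -/
theorem IsGaloisGroup.of_card_eq_finrank (A B N : Type*) [CommRing A] [CommRing B]
    [IsDomain A] [IsDomain B] [IsIntegrallyClosed A] [Algebra A B] [FaithfulSMul A B]
    [Module.Finite A B] [Group N] [Finite N] [MulSemiringAction N B] [FaithfulSMul N B]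
    [SMulCommClass N A B] (h : Nat.card N = Module.finrank A B) : IsGaloisGroup N A B := by
  let K := FractionRing A
  let L := FractionRing B
  let : Algebra K L := FractionRing.liftAlgebra A L
  let : MulSemiringAction N L := IsFractionRing.mulSemiringAction N B L
  rw [← IsFractionRing.finrank_eq A K B L] at h
  have : FaithfulSMul N L := IsFractionRing.faithfulSMul N B L
  have : SMulCommClass N K L := IsFractionRing.smulCommClass N A B K L
  have : Module.Finite K L := Module.finite_of_finrank_pos (h ▸ Nat.card_pos)
  -- `N` embeds in the automorphism group of `L/K`, whose order is at most the degree, which is the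
  -- order of `N`; so all three numbers agree.
  let φ : N →* Gal(L/K) := MulSemiringAction.toAlgAut N K L
  have hφ : Function.Injective φ := fun a b hab ↦
    eq_of_smul_eq_smul fun x : L ↦ DFunLike.congr_fun hab x
  have h1 : Nat.card N ≤ Nat.card Gal(L/K) := Nat.card_le_card_of_injective φ hφ
  have h2 : Nat.card Gal(L/K) ≤ Module.finrank K L := by
    rw [Nat.card_eq_fintype_card]; exact AlgEquiv.card_le
  have : IsGalois K L := IsGalois.of_card_aut_eq_finrank K L (by omega)
  have hbij : Function.Bijective φ :=
    (Nat.bijective_iff_injective_and_card φ).mpr ⟨hφ, by omega⟩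
  have : IsGaloisGroup N K L :=
    .of_mulEquiv (hG := IsGaloisGroup.of_isGalois K L) (MulEquiv.ofBijective φ hbij) fun _ _ ↦ rfl
  exact IsGaloisGroup.of_isFractionRing N A B K L

open scoped Pointwise in
/-- In a Galois extension with trivial residue field extension at `P`, being unramified at `P`
means that `P` has trivial stabilizer. -/
theorem IsGaloisGroup.isUnramifiedAt_iff_stabilizer_eq_bot (A B H : Type*) [CommRing A]
    [CommRing B] [IsDedekindDomain A] [IsDomain B] [Algebra A B] [FaithfulSMul A B]
    [Module.Finite A B] [Group H] [Finite H] [MulSemiringAction H B] [IsGaloisGroup H A B]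
    (P : Ideal B) [P.IsMaximal] (hP : Function.Surjective (algebraMap A (B ⧸ P)))
    [PerfectField (P.under A).ResidueField] :
    Algebra.IsUnramifiedAt A P ↔ MulAction.stabilizer H P = ⊥ := by
  let p := P.under A
  let := Localization.AtPrime.algebraOfLiesOver p P
  have hres : Function.Surjective (algebraMap p.ResidueField P.ResidueField) := by
    intro x
    obtain ⟨y, rfl⟩ := P.bijective_algebraMap_quotient_residueField.2 x
    obtain ⟨a, rfl⟩ := hP y
    refine ⟨algebraMap A _ a, ?_⟩
    rw [← IsScalarTower.algebraMap_apply, ← IsScalarTower.algebraMap_apply]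
  have hdeg : P.inertiaDeg A = 1 := by
    rw [Ideal.inertiaDeg_eq p P]
    exact (LinearEquiv.ofBijective (Algebra.linearMap p.ResidueField P.ResidueField)
      ⟨(algebraMap p.ResidueField P.ResidueField).injective, hres⟩).finrank_eq.symm.trans (Module.finrank_self _)
  have := Algebra.IsInvariant.isIntegral A B H
  -- The stabilizer has order `e f`, and `f = 1`.
  rw [← Ideal.ramificationIdx_eq_one_iff, ← Subgroup.card_eq_one, Ideal.card_stabilizer_eq p P,
    Ideal.inertiaDegIn_eq_inertiaDeg p P H, Ideal.ramificationIdxIn_eq_ramificationIdx p P H,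
    hdeg, mul_one]

namespace CurveCovers

variable {k : Type u} [Field k]

/-! ### Affine open subschemes of curves -/

theorem le_preimage_top {X Y : Scheme.{u}} (f : X ⟶ Y) (U : X.Opens) : U ≤ f ⁻¹ᵁ ⊤ := le_top

/-- Sections of a `k`-scheme form a `k`-algebra. -/
noncomputable instance sectionsAlgebra (X : Over (Spec (.of k))) (U : X.left.Opens) :
    Algebra k Γ(X.left, U) :=
  ((Scheme.ΓSpecIso (.of k)).inv ≫ X.hom.appLE ⊤ U (le_preimage_top _ U)).hom.toAlgebra

theorem algebraMap_sections_comp_appLE {X Y : Over (Spec (.of k))} (f : X ⟶ Y) (U : Y.left.Opens)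
    (V : X.left.Opens) (e : V ≤ f.left ⁻¹ᵁ U) :
    (f.left.appLE U V e).hom.comp (algebraMap k Γ(Y.left, U)) = algebraMap k Γ(X.left, V) := by
  change ((((Scheme.ΓSpecIso (.of k)).inv ≫ Y.hom.appLE ⊤ U (le_preimage_top _ U)) ≫ f.left.appLE U V e).hom) =
    ((Scheme.ΓSpecIso (.of k)).inv ≫ X.hom.appLE ⊤ V (le_preimage_top _ V)).hom
  have : X.hom = f.left ≫ Y.hom := (Over.w f).symm
  rw [Category.assoc, Scheme.Hom.appLE_comp_appLE]
  simp only [this]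

/-- Pullback of sections as a homomorphism of `k`-algebras. -/
noncomputable def sectionsMap {X Y : Over (Spec (.of k))} (f : X ⟶ Y) (U : Y.left.Opens)
    (V : X.left.Opens) (e : V ≤ f.left ⁻¹ᵁ U) : Γ(Y.left, U) →ₐ[k] Γ(X.left, V) where
  __ := (f.left.appLE U V e).hom
  commutes' c := DFunLike.congr_fun (algebraMap_sections_comp_appLE f U V e) c

theorem finiteType_sections (X : Over (Spec (.of k))) [LocallyOfFiniteType X.hom]
    {U : X.left.Opens} (hU : IsAffineOpen U) : Algebra.FiniteType k Γ(X.left, U) := by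
  have h := X.hom.finiteType_appLE (isAffineOpen_top (Spec (.of k))) hU (le_preimage_top _ U)
  exact RingHom.FiniteType.comp h (RingHom.FiniteType.of_surjective _
    (Scheme.ΓSpecIso (.of k)).commRingCatIsoToRingEquiv.symm.surjective)

variable (X : Over (Spec (.of k))) [IsSmoothProperCurve X]

theorem exists_isAffineOpen_isStandardSmooth (x : X.left) :
    ∃ V : X.left.Opens, IsAffineOpen V ∧ x ∈ V ∧
      Algebra.IsStandardSmoothOfRelativeDimension 1 k Γ(X.left, V) := by
  obtain ⟨U, hU, V, hV, hx, e, h⟩ :=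
    SmoothOfRelativeDimension.exists_isStandardSmoothOfRelativeDimension (n := 1) (f := X.hom) x
  -- The spectrum of a field has a single point.
  obtain rfl : U = ⊤ := by
    ext y
    simpa [Subsingleton.elim y (X.hom x)] using e hx
  refine ⟨V, hV, hx, ?_⟩
  have := h.comp (RingHom.IsStandardSmoothOfRelativeDimension.equiv
    (Scheme.ΓSpecIso (.of k)).commRingCatIsoToRingEquiv.symm)
  exact this

/-- If every section were a constant, a basic open subset of `U` with a point in it would be all of
`U`. Near any point such a subset is also basic in a standard smooth chart, whose localizations have
nonconstant sections. -/
theorem not_surjective_algebraMap_sections {U : X.left.Opens} (hU : IsAffineOpen U)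
    (hne : (U : Set X.left).Nonempty) :
    ¬ Function.Surjective (algebraMap k Γ(X.left, U)) := by
  intro h
  obtain ⟨x, hx⟩ := hne
  obtain ⟨V, hV, hxV, _⟩ := exists_isAffineOpen_isStandardSmooth X x
  obtain ⟨f, g, hfg, hxf⟩ := exists_basicOpen_le_affine_inter hU hV x ⟨hx, hxV⟩
  have : Nonempty U := ⟨⟨x, hx⟩⟩
  have hf : IsUnit f := by
    obtain ⟨c, rfl⟩ := h f
    refine (IsUnit.mk0 c ?_).map _
    rintro rfl
    simp at hxf
  have hUg : U = X.left.basicOpen g := by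
    rw [← hfg, Scheme.basicOpen_of_isUnit _ hf]
  have h0 := hV.isLocalization_basicOpen g
  have : IsScalarTower k Γ(X.left, V) Γ(X.left, X.left.basicOpen g) :=
    .of_algebraMap_eq' (algebraMap_sections_comp_appLE (𝟙 X) V _ (X.left.basicOpen_le g)).symm
  have := Algebra.IsStandardSmoothOfRelativeDimension.localization_away g
    (S := Γ(X.left, X.left.basicOpen g))
  have := Algebra.IsStandardSmoothOfRelativeDimension.trans 1 0 k Γ(X.left, V)
    Γ(X.left, X.left.basicOpen g)
  have : Nonempty (X.left.basicOpen g) := ⟨⟨x, hfg.le hxf⟩⟩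
  exact Algebra.IsStandardSmoothOfRelativeDimension.not_surjective_algebraMap k _ (hUg ▸ h)

/-- A stalk is a localization of a Dedekind domain at a prime: a field at the zero ideal and a
discrete valuation ring elsewhere. -/
instance isPrincipalIdealRing_stalk (x : X.left) :
    IsPrincipalIdealRing (X.left.presheaf.stalk x) := by
  obtain ⟨V, hV, hxV, _⟩ := exists_isAffineOpen_isStandardSmooth X x
  have : Nonempty V := ⟨⟨x, hxV⟩⟩
  have := IsDedekindDomain.of_isStandardSmoothOfRelativeDimension_one k Γ(X.left, V)
  obtain ⟨x, rfl⟩ : ∃ x' : V, x'.1 = x := ⟨⟨x, hxV⟩, rfl⟩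
  have := hV.isLocalization_stalk x
  by_cases h : (hV.primeIdealOf x).asIdeal = ⊥
  · have : IsFractionRing Γ(X.left, V) (X.left.presheaf.stalk x.1) := by
      rw [IsFractionRing, ← Ideal.primeCompl_bot]
      convert this
      exact h.symm
    exact IsField.isPrincipalIdealRing
      (@Field.toIsField _ (IsFractionRing.toField Γ(X.left, V)))
  · have := IsLocalization.AtPrime.isDiscreteValuationRing_of_dedekind_domain Γ(X.left, V) h
      (X.left.presheaf.stalk x.1)
    infer_instance

instance valuationRing_stalk (x : X.left) : ValuationRing (X.left.presheaf.stalk x) :=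
  ValuationRing.iff_local_bezout_domain.2 ⟨inferInstance, inferInstance⟩

/-- An arbitrary affine open need not be standard smooth, so the property is checked on stalks. -/
theorem isDedekindDomain_sections {U : X.left.Opens} (hU : IsAffineOpen U) [Nonempty U] :
    IsDedekindDomain Γ(X.left, U) := by
  have := finiteType_sections X hU
  have : IsNoetherianRing Γ(X.left, U) := Algebra.FiniteType.isNoetherianRing k _
  have : IsDedekindDomainDvr Γ(X.left, U) :=
    { __ := (inferInstance : IsNoetherianRing Γ(X.left, U))
      is_dvr_at_nonzero_prime := fun P hP _ ↦ by
        obtain ⟨x, hx⟩ : ∃ x : U, (hU.primeIdealOf x).asIdeal = P :=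
          ⟨⟨hU.fromSpec ⟨P, ‹_›⟩, hU.opensRange_fromSpec.le ⟨_, rfl⟩⟩, by
            exact congrArg PrimeSpectrum.asIdeal
              (hU.fromSpec.isOpenEmbedding.injective (hU.fromSpec_primeIdealOf _))⟩
        have h1 := hU.isLocalization_stalk x
        have e : X.left.presheaf.stalk x.1 ≃+* Localization.AtPrime P := by
          subst hx
          exact (IsLocalization.algEquiv (hU.primeIdealOf x).asIdeal.primeCompl _ _).toRingEquiv
        have : IsPrincipalIdealRing (Localization.AtPrime P) :=
          IsPrincipalIdealRing.of_surjective e e.surjective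
        have h := IsLocalization.AtPrime.not_isField Γ(X.left, U) hP (Localization.AtPrime P)
        rw [IsLocalRing.isField_iff_maximalIdeal_eq] at h
        exact { not_a_field' := h } }
  exact IsDedekindDomainDvr.isDedekindDomain _

end CurveCovers

namespace CurveCovers

variable {k : Type u} [Field k]

/-! ### Groups of automorphisms acting on sections -/

/-- Two `k`-morphisms that induce the same map on sections over a nonempty affine open agree. -/
theorem hom_ext_of_appLE_eq {X Y : Over (Spec (.of k))} [IsIntegral X.left] [IsSeparated Y.hom]
    {f g : X ⟶ Y} {U : Y.left.Opens} {V : X.left.Opens} (hU : IsAffineOpen U) (hV : IsAffineOpen V)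
    (hne : (V : Set X.left).Nonempty) (hf : V ≤ f.left ⁻¹ᵁ U) (hg : V ≤ g.left ⁻¹ᵁ U)
    (h : f.left.appLE U V hf = g.left.appLE U V hg) : f = g := by
  -- A nonempty open subset is dense, and morphisms from a reduced scheme to a separated one are
  -- determined on a dense open.
  have : IsDominant hV.fromSpec := by
    refine ⟨?_⟩
    rw [DenseRange, hV.range_fromSpec]
    exact V.2.dense hne
  ext1
  refine ext_of_isDominant_of_isSeparated Y.hom ((Over.w f).trans (Over.w g).symm) hV.fromSpec ?_
  rw [← IsAffineOpen.SpecMap_appLE_fromSpec _ hU hV hf,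
    ← IsAffineOpen.SpecMap_appLE_fromSpec _ hU hV hg, h]

/-- An open subscheme is stable under a group of automorphisms. -/
def IsStable {X : Over (Spec (.of k))} (H : Subgroup (Aut X)) (U : X.left.Opens) : Prop :=
  ∀ σ ∈ H, U ≤ σ.hom.left ⁻¹ᵁ U

theorem isStable_preimage {X Y : Over (Spec (.of k))} (f : X ⟶ Y) {H : Subgroup (Aut X)}
    (hH : H ≤ autOver f) (W : Y.left.Opens) : IsStable H (f.left ⁻¹ᵁ W) := by
  intro σ hσ
  have : σ.hom ≫ f = f := hH hσ
  have h : σ.hom.left ≫ f.left = f.left := congrArg CommaMorphism.left this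
  rw [← Scheme.Hom.comp_preimage, h]

theorem sectionsMap_comp_apply {X Y Z : Over (Spec (.of k))} (f : X ⟶ Y) (g : Y ⟶ Z)
    {U : Z.left.Opens} {V : Y.left.Opens} {W : X.left.Opens} (hf : W ≤ f.left ⁻¹ᵁ V)
    (hg : V ≤ g.left ⁻¹ᵁ U) (hfg : W ≤ (f ≫ g).left ⁻¹ᵁ U) (b : Γ(Z.left, U)) :
    sectionsMap f V W hf (sectionsMap g U V hg b) = sectionsMap (f ≫ g) U W hfg b :=
  congr($(Scheme.Hom.appLE_comp_appLE f.left g.left U V W hg hf) b)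

@[simp]
theorem sectionsMap_id_apply {X : Over (Spec (.of k))} {U : X.left.Opens}
    (h : U ≤ (𝟙 X : X ⟶ X).left ⁻¹ᵁ U) (b : Γ(X.left, U)) : sectionsMap (𝟙 X) U U h b = b := by
  have h : (𝟙 X.left : X.left ⟶ X.left).appLE U U le_rfl = 𝟙 _ :=
    (Scheme.Hom.appLE_eq_app (𝟙 X.left)).trans (Scheme.Hom.id_app U)
  exact congr($h b)

/-- The action of a group of automorphisms on the sections over a stable open subscheme. -/
noncomputable abbrev sectionsAction {X : Over (Spec (.of k))} {H : Subgroup (Aut X)}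
    {U : X.left.Opens} (hU : IsStable H U) : MulSemiringAction H Γ(X.left, U) where
  -- Pullback is contravariant, so the inverse is needed for a left action.
  smul σ b := sectionsMap (σ⁻¹).1.hom U U (hU _ (σ⁻¹).2) b
  one_smul b := sectionsMap_id_apply (hU 1 H.one_mem) b
  mul_smul σ τ b := (sectionsMap_comp_apply (σ⁻¹).1.hom (τ⁻¹).1.hom _ _
    (hU (σ * τ)⁻¹ (H.inv_mem (σ * τ).2)) b).symm
  smul_zero _ := map_zero _
  smul_add _ _ _ := map_add _ _ _
  smul_one _ := map_one _
  smul_mul _ _ _ := map_mul _ _ _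

section

variable {X : Over (Spec (.of k))} {H : Subgroup (Aut X)} {U : X.left.Opens} (hU : IsStable H U)

theorem sectionsAction_smul_eq (σ : H) (b : Γ(X.left, U)) :
    letI := sectionsAction hU
    σ • b = sectionsMap (σ⁻¹).1.hom U U (hU _ (σ⁻¹).2) b := rfl

theorem sectionsAction_smulCommClass :
    letI := sectionsAction hU
    SMulCommClass H k Γ(X.left, U) := by
  let := sectionsAction hU
  exact ⟨fun σ c b ↦ map_smul (sectionsMap (σ⁻¹).1.hom U U (hU _ (σ⁻¹).2)) c b⟩

theorem sectionsAction_faithfulSMul [IsIntegral X.left] [IsSeparated X.hom] (hU' : IsAffineOpen U)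
    (hne : (U : Set X.left).Nonempty) :
    letI := sectionsAction hU
    FaithfulSMul H Γ(X.left, U) := by
  let := sectionsAction hU
  refine ⟨fun {σ τ} h ↦ ?_⟩
  have := hom_ext_of_appLE_eq hU' hU' hne (hU _ (σ⁻¹).2) (hU _ (τ⁻¹).2)
    (by ext b; exact h b)
  exact inv_injective (Subtype.ext (Iso.ext this))

theorem sectionsAction_forall_smul_eq_iff (b : Γ(X.left, U)) :
    letI := sectionsAction hU
    (∀ σ : H, σ • b = b) ↔ ∀ (σ) (hσ : σ ∈ H), sectionsMap σ.hom U U (hU σ hσ) b = b := by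
  let := sectionsAction hU
  refine ⟨fun h σ hσ ↦ ?_, fun h σ ↦ h _ (σ⁻¹).2⟩
  simpa [sectionsAction_smul_eq] using h ⟨σ⁻¹, H.inv_mem hσ⟩

end

/-- A morphism makes the sections over an open subscheme of the preimage an algebra. -/
noncomputable abbrev sectionsAlgebraOfHom {X Y : Over (Spec (.of k))} (f : X ⟶ Y)
    (W : Y.left.Opens) : Algebra Γ(Y.left, W) Γ(X.left, f.left ⁻¹ᵁ W) :=
  (sectionsMap f W (f.left ⁻¹ᵁ W) le_rfl).toRingHom.toAlgebra

section

variable {X Y : Over (Spec (.of k))} (f : X ⟶ Y) (W : Y.left.Opens)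

theorem sectionsAlgebraOfHom_isScalarTower :
    letI := sectionsAlgebraOfHom f W
    IsScalarTower k Γ(Y.left, W) Γ(X.left, f.left ⁻¹ᵁ W) :=
  letI := sectionsAlgebraOfHom f W
  .of_algebraMap_eq' (algebraMap_sections_comp_appLE f W _ le_rfl).symm

theorem sectionsAction_smulCommClass_of_le_autOver {H : Subgroup (Aut X)} (hH : H ≤ autOver f) :
    letI := sectionsAlgebraOfHom f W
    letI := sectionsAction (isStable_preimage f hH W)
    SMulCommClass H Γ(Y.left, W) Γ(X.left, f.left ⁻¹ᵁ W) := by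
  let := sectionsAlgebraOfHom f W
  let := sectionsAction (isStable_preimage f hH W)
  refine ⟨fun σ a b ↦ ?_⟩
  have h : σ • algebraMap Γ(Y.left, W) Γ(X.left, f.left ⁻¹ᵁ W) a = algebraMap _ _ a := by
    have h : (σ⁻¹).1.hom ≫ f = f := hH (σ⁻¹).2
    refine (sectionsMap_comp_apply (σ⁻¹).1.hom f _ le_rfl
      (isStable_preimage f hH W _ (σ⁻¹).2) a).trans ?_
    simp only [h]
    rfl
  rw [Algebra.smul_def a b, smul_mul', h]
  exact (Algebra.smul_def a (σ • b)).symm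

theorem module_finite_sections [IsFinite f.left] (hW : IsAffineOpen W) :
    letI := sectionsAlgebraOfHom f W
    Module.Finite Γ(Y.left, W) Γ(X.left, f.left ⁻¹ᵁ W) := by
  let := sectionsAlgebraOfHom f W
  have := IsFinite.finite_app f.left W hW
  rw [Scheme.Hom.app_eq_appLE] at this
  exact this

theorem faithfulSMul_sections [IsIntegral Y.left] [IsDominant f.left] [QuasiCompact f.left] :
    letI := sectionsAlgebraOfHom f W
    FaithfulSMul Γ(Y.left, W) Γ(X.left, f.left ⁻¹ᵁ W) := by
  let := sectionsAlgebraOfHom f W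
  have := IsSchemeTheoreticallyDominant.of_isDominant f.left
  have := Scheme.Hom.app_injective f.left W
  rw [Scheme.Hom.app_eq_appLE] at this
  exact (faithfulSMul_iff_algebraMap_injective _ _).2 this

/-- A dominant morphism of irreducible schemes maps the generic point to the generic point. -/
theorem map_genericPoint {X Y : Scheme.{u}} [IrreducibleSpace X] [IrreducibleSpace Y] (f : X ⟶ Y)
    [IsDominant f] : f (genericPoint X) = genericPoint Y := by
  refine IsGenericPoint.eq ?_ (genericPoint_spec Y)
  have := (genericPoint_spec X).image f.continuous
  rwa [Set.image_univ, f.denseRange.closure_range] at this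

/-- The degree of a cover is the rank of the sections over any nonempty affine open subscheme. -/
theorem degree_eq_finrank_sections [IsIntegral X.left] [IsIntegral Y.left] [IsDominant f.left]
    [IsAffineHom f.left] (hW : IsAffineOpen W) (hne : (W : Set Y.left).Nonempty) :
    letI := sectionsAlgebraOfHom f W
    degree f.left = Module.finrank Γ(Y.left, W) Γ(X.left, f.left ⁻¹ᵁ W) := by
  let := sectionsAlgebraOfHom f W
  let η := genericPoint X.left
  have hfη : f.left η = genericPoint Y.left := map_genericPoint f.left
  have : Nonempty W := hne.to_subtype
  have hη : f.left η ∈ W := by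
    rw [hfη]
    exact ((genericPoint_spec Y.left).mem_open_set_iff W.isOpen).2 (by simpa using hne)
  have : Nonempty (f.left ⁻¹ᵁ W) := ⟨⟨η, hη⟩⟩
  let : Algebra (Y.left.presheaf.stalk (f.left η)) X.left.functionField :=
    (f.left.stalkMap η).hom.toAlgebra
  let : Algebra Γ(Y.left, W) (Y.left.presheaf.stalk (f.left η)) :=
    (Y.left.presheaf.germ W _ hη).hom.toAlgebra
  have := functionField_isFractionRing_of_isAffineOpen X.left (f.left ⁻¹ᵁ W) (hW.preimage f.left)
  have : IsFractionRing Γ(Y.left, W) (Y.left.presheaf.stalk (f.left η)) := by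
    -- The stalk at `f η` is only propositionally the function field of `Y`; generalizing the point
    -- allows substitution.
    have (y : Y.left) (hy : y = genericPoint Y.left) (hyW : y ∈ W) :
        @IsFractionRing Γ(Y.left, W) _ (Y.left.presheaf.stalk y) _
          (Y.left.presheaf.germ W y hyW).hom.toAlgebra := by
      subst hy
      exact functionField_isFractionRing_of_isAffineOpen Y.left W hW
    exact this _ hfη hη
  let : Algebra Γ(Y.left, W) X.left.functionField :=
    ((algebraMap Γ(X.left, f.left ⁻¹ᵁ W) X.left.functionField).comp
      (algebraMap Γ(Y.left, W) Γ(X.left, f.left ⁻¹ᵁ W))).toAlgebra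
  have : IsScalarTower Γ(Y.left, W) Γ(X.left, f.left ⁻¹ᵁ W) X.left.functionField :=
    .of_algebraMap_eq' rfl
  have : IsScalarTower Γ(Y.left, W) (Y.left.presheaf.stalk (f.left η)) X.left.functionField := by
    refine .of_algebraMap_eq' ?_
    have h := Scheme.Hom.germ_stalkMap f.left W η hη
    rw [Scheme.Hom.app_eq_appLE] at h
    exact congrArg CommRingCat.Hom.hom h.symm
  exact IsFractionRing.finrank_eq Γ(Y.left, W) (Y.left.presheaf.stalk (f.left η))
    Γ(X.left, f.left ⁻¹ᵁ W) X.left.functionField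

end

/-- The image of the generic point under a generically étale morphism with integral target is
dense. -/
theorem GenericallyEtale.isDominant {X Y : Scheme.{u}} [IsIntegral Y] {f : X ⟶ Y}
    (h : GenericallyEtale f) : IsDominant f := by
  obtain ⟨U, ⟨x, hx⟩, h⟩ := h
  refine ⟨?_⟩
  have ho : IsOpen (Set.range (U.ι ≫ f)) := (U.ι ≫ f).isOpenMap.isOpen_range
  refine (ho.dense ⟨_, ⟨⟨x, hx⟩, rfl⟩⟩).mono ?_
  rintro _ ⟨y, rfl⟩
  exact ⟨U.ι y, rfl⟩

end CurveCovers

/-! ### Universal property of quotients by invariants -/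

theorem appLE_injective_of_app_injective {X Y : Scheme.{u}} (f : X ⟶ Y) {V : Y.Opens}
    (h : Function.Injective (f.app V)) {U : X.Opens} (e : U ≤ f ⁻¹ᵁ V) (e' : f ⁻¹ᵁ V ≤ U) :
    Function.Injective (f.appLE V U e) := by
  obtain rfl := le_antisymm e e'
  rwa [Scheme.Hom.appLE_eq_app]

theorem toImage_app_injective' {X Y : Scheme.{u}} (f : X ⟶ Y) [QuasiCompact f]
    (V : f.image.Opens) : Function.Injective (f.toImage.app V) :=
  TopCat.Presheaf.app_injective_of_stalkFunctor_map_injective (F := f.image.sheaf) f.toImage.c V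
    fun x _ ↦ f.stalkFunctor_toImage_injective x

/-- Let `f : X ⟶ Y` be a finite dominant morphism such that `𝒪_Y` is the sheaf of sections of
`f_* 𝒪_X` invariant under a family of endomorphisms. If `f` factors through a proper morphism
`p : I ⟶ Y` by means of an invariant, schematically dominant morphism, then `p` is an
isomorphism. -/
theorem isIso_of_invariant {X Y I : Scheme.{u}} {ι : Type*} {f : X ⟶ Y} (t : X ⟶ I) {p : I ⟶ Y}
    (htp : t ≫ p = f) [IsFinite f] [IsDominant f] [IsReduced Y] [IsProper p] [IsDominant t]
    (ht : ∀ V, Function.Injective (t.app V)) (σ : ι → (X ⟶ X)) (hσ : ∀ i, σ i ≫ t = t)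
    (h : ∀ W : Y.Opens, IsAffineOpen W → ∀ s : Γ(X, f ⁻¹ᵁ W),
      (∀ i e, (σ i).appLE (f ⁻¹ᵁ W) (f ⁻¹ᵁ W) e s = s) → ∃ a, f.app W a = s) : IsIso p := by
  -- Since `t ≫ p` is finite and `p` separated, `t` is closed and dominant, hence surjective. So the
  -- fibres of `p` are images of fibres of `f`, and a proper morphism with finite fibres is finite.
  have : UniversallyClosed t := by
    have : UniversallyClosed (t ≫ p) := by rw [htp]; infer_instance
    exact .of_comp_of_isSeparated _ p
  have : Surjective t := Surjective.of_universallyClosed_of_isDominant _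
  have : LocallyQuasiFinite p := by
    refine .of_finite_preimage_singleton _ fun x ↦ ?_
    refine ((f.finite_preimage_singleton x).image t).subset fun y hy ↦ ?_
    obtain ⟨x', rfl⟩ := t.surjective y
    refine ⟨x', ?_, rfl⟩
    rw [← htp]
    exact hy
  have : IsFinite p := .of_isProper_of_locallyQuasiFinite p
  refine (IsZariskiLocalAtTarget.iff_of_iSup_eq_top
    (P := MorphismProperty.isomorphisms Scheme.{u}) _ (iSup_affineOpens_eq_top Y)).2
    fun ⟨W, hW⟩ ↦ ?_
  refine (isIso_morphismRestrict_iff_isIso_app p hW).2 ?_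
  have e' : t ⁻¹ᵁ p ⁻¹ᵁ W = f ⁻¹ᵁ W := by
    rw [← Scheme.Hom.comp_preimage, htp]
  have he : f.app W = p.app W ≫ t.appLE (p ⁻¹ᵁ W) (f ⁻¹ᵁ W) e'.ge := by
    rw [Scheme.Hom.app_eq_appLE, Scheme.Hom.app_eq_appLE, Scheme.Hom.appLE_comp_appLE]
    simp only [htp]
  have : IsSchemeTheoreticallyDominant f := .of_isDominant f
  rw [ConcreteCategory.isIso_iff_bijective]
  -- Injectivity follows from that of `f.app W`. For surjectivity, the pullback of `s` along `t` is
  -- invariant, so it comes from `W`, and injectivity of `t` on sections returns `s`.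
  refine ⟨fun a b hab ↦ f.app_injective W ?_, fun s ↦ ?_⟩
  · rw [he]
    exact congrArg (t.appLE (p ⁻¹ᵁ W) (f ⁻¹ᵁ W) e'.ge) hab
  · obtain ⟨a, ha⟩ := h W hW (t.appLE (p ⁻¹ᵁ W) (f ⁻¹ᵁ W) e'.ge s) fun i h' ↦ by
      have := Scheme.Hom.appLE_comp_appLE (σ i) t (p ⁻¹ᵁ W) (f ⁻¹ᵁ W) (f ⁻¹ᵁ W) e'.ge h'
      simp only [hσ] at this
      exact congr($this s)
    refine ⟨a, appLE_injective_of_app_injective t (ht _) e'.ge e'.le ?_⟩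
    rw [he] at ha
    exact ha

/-- A finite dominant morphism `f : X ⟶ Y` such that `𝒪_Y` is the sheaf of sections of `f_* 𝒪_X`
invariant under a family of endomorphisms has the universal property of a quotient for morphisms
to proper schemes. -/
theorem exists_comp_eq_of_invariant {X Y Z S : Scheme.{u}} {ι : Type*} (f : X ⟶ Y) (g : X ⟶ Z)
    (y : Y ⟶ S) (z : Z ⟶ S) (w : f ≫ y = g ≫ z) [IsFinite f] [IsDominant f] [IsReduced Y]
    [IsProper z] (σ : ι → (X ⟶ X)) (hf : ∀ i, σ i ≫ f = f) (hg : ∀ i, σ i ≫ g = g)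
    (h : ∀ W : Y.Opens, IsAffineOpen W → ∀ s : Γ(X, f ⁻¹ᵁ W),
      (∀ i e, (σ i).appLE (f ⁻¹ᵁ W) (f ⁻¹ᵁ W) e s = s) → ∃ a, f.app W a = s) :
    ∃ ψ : Y ⟶ Z, f ≫ ψ = g ∧ ψ ≫ z = y := by
  -- The image of `q` will be the graph of the required morphism: its projection to `Y` is an
  -- isomorphism, and the other projection then gives `ψ`.
  let q : X ⟶ Limits.pullback y z := Limits.pullback.lift f g w
  have hq₁ : q ≫ Limits.pullback.fst _ _ = f := Limits.pullback.lift_fst _ _ _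
  have hq₂ : q ≫ Limits.pullback.snd _ _ = g := Limits.pullback.lift_snd _ _ _
  have : QuasiCompact q := by
    have : QuasiCompact (q ≫ Limits.pullback.fst y z) := by rw [hq₁]; infer_instance
    exact .of_comp q (Limits.pullback.fst y z)
  have hqp : q.toImage ≫ q.imageι ≫ Limits.pullback.fst _ _ = f := by simp [hq₁]
  have hq (i) : σ i ≫ q.toImage = q.toImage := by
    rw [← cancel_mono q.imageι, Category.assoc, Scheme.Hom.toImage_imageι]
    ext <;> simp [hq₁, hq₂, hf, hg]
  have : IsIso (q.imageι ≫ Limits.pullback.fst _ _) :=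
    isIso_of_invariant q.toImage hqp (toImage_app_injective' q) σ hq h
  refine ⟨inv (q.imageι ≫ Limits.pullback.fst _ _) ≫ q.imageι ≫ Limits.pullback.snd _ _, ?_, ?_⟩
  · have : f ≫ inv (q.imageι ≫ Limits.pullback.fst _ _) = q.toImage := by
      rw [IsIso.comp_inv_eq, hqp]
    rw [reassoc_of% this]
    simp [hq₂]
  · rw [Category.assoc, IsIso.inv_comp_eq, Category.assoc, Category.assoc,
      Limits.pullback.condition]

namespace CurveCovers

variable {k : Type u} [Field k]

/-! ### Galois covers are quotient maps -/

attribute [instance] GaloisCover.target_isCurve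

section

variable {X : Over (Spec (.of k))} [IsSmoothProperCurve X] {G : Type*} [Group G]

instance (c : GaloisCover X G) : IsFinite c.map.left := c.isBranchedCover.isFinite

instance (c : GaloisCover X G) : IsDominant c.map.left :=
  c.isBranchedCover.genericallyEtale.isDominant

instance (c : GaloisCover X G) : Surjective c.map.left :=
  Surjective.of_universallyClosed_of_isDominant _

theorem GaloisCover.finite_autOver [Finite G] (c : GaloisCover X G) : Finite (autOver c.map) :=
  let ⟨e⟩ := c.aut_iso
  Finite.of_equiv G e.symm

/-- The order of the faithful group `Aut(X/Y)` is the degree, which is the rank of the sections, and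
the base is integrally closed. -/
theorem isGaloisGroup_sections [Finite G] (c : GaloisCover X G) {W : c.target.left.Opens}
    (hW : IsAffineOpen W) (hne : (W : Set c.target.left).Nonempty) :
    letI := sectionsAlgebraOfHom c.map W
    letI := sectionsAction (isStable_preimage c.map le_rfl W)
    IsGaloisGroup (autOver c.map) Γ(c.target.left, W) Γ(X.left, c.map.left ⁻¹ᵁ W) := by
  let := sectionsAlgebraOfHom c.map W
  let := sectionsAction (isStable_preimage c.map le_rfl W)
  have := c.finite_autOver
  have hne' : (c.map.left ⁻¹ᵁ W : Set X.left).Nonempty := hne.preimage c.map.left.surjective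
  have : Nonempty W := hne.to_subtype
  have : Nonempty (c.map.left ⁻¹ᵁ W) := hne'.to_subtype
  have := isDedekindDomain_sections c.target hW
  have := isDedekindDomain_sections X (hW.preimage c.map.left)
  have := module_finite_sections c.map W hW
  have := faithfulSMul_sections c.map W
  have := sectionsAction_faithfulSMul (isStable_preimage c.map le_rfl W)
    (hW.preimage c.map.left) hne'
  have := sectionsAction_smulCommClass_of_le_autOver c.map W le_rfl
  exact IsGaloisGroup.of_card_eq_finrank _ _ _
    (c.card_aut_eq_degree.trans (degree_eq_finrank_sections c.map W hW hne))

/-- A Galois cover is a quotient by its automorphism group: invariant morphisms to proper schemes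
factor through it. -/
theorem GaloisCover.exists_map_comp_eq [Finite G] (c : GaloisCover X G) {Z : Over (Spec (.of k))}
    [IsProper Z.hom] (g : X ⟶ Z) (hg : ∀ σ ∈ autOver c.map, σ.hom ≫ g = g) :
    ∃ ψ : c.target ⟶ Z, c.map ≫ ψ = g := by
  obtain ⟨ψ, h, h'⟩ := exists_comp_eq_of_invariant c.map.left g.left c.target.hom Z.hom
    ((Over.w _).trans (Over.w _).symm) (fun σ : autOver c.map ↦ σ.1.hom.left)
    (fun σ ↦ congrArg CommaMorphism.left (show σ.1.hom ≫ c.map = c.map from σ.2))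
    (fun σ ↦ congrArg CommaMorphism.left (hg _ σ.2)) fun W hW s hs ↦ by
      -- Over the empty set the ring of sections is zero and Galois theory does not apply.
      by_cases hne : (W : Set c.target.left).Nonempty
      · let := sectionsAlgebraOfHom c.map W
        let := sectionsAction (isStable_preimage c.map le_rfl W)
        have := isGaloisGroup_sections c hW hne
        obtain ⟨a, ha⟩ := Algebra.IsInvariant.isInvariant (A := Γ(c.target.left, W))
          (G := autOver c.map) s fun σ ↦ hs (σ⁻¹) _
        refine ⟨a, ?_⟩
        rw [Scheme.Hom.app_eq_appLE]
        exact ha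
      · obtain rfl : W = ⊥ := by
          rwa [Set.not_nonempty_iff_eq_empty, TopologicalSpace.Opens.coe_eq_empty] at hne
        exact ⟨0, Subsingleton.elim (α := Γ(X.left, ⊥)) _ _⟩
  exact ⟨Over.homMk ψ h', by ext1; exact h⟩

theorem GaloisCover.map_comp_cancel (c : GaloisCover X G) {Z : Over (Spec (.of k))}
    [IsSeparated Z.hom] {ψ φ : c.target ⟶ Z} (h : c.map ≫ ψ = c.map ≫ φ) : ψ = φ := by
  ext1
  exact ext_of_isDominant_of_isSeparated Z.hom ((Over.w ψ).trans (Over.w φ).symm) c.map.left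
    (congrArg CommaMorphism.left h)

/-- Each map is invariant under the group of the other, so each factors through the other; dominance
makes the two factors mutually inverse. -/
theorem equiv_of_autOver_eq [Finite G] (c₁ c₂ : GaloisCover X G)
    (h : autOver c₁.map = autOver c₂.map) : c₁ ≈ c₂ := by
  obtain ⟨φ, hφ⟩ := c₁.exists_map_comp_eq c₂.map fun σ hσ ↦ (h.le hσ :)
  obtain ⟨ψ, hψ⟩ := c₂.exists_map_comp_eq c₁.map fun σ hσ ↦ (h.ge hσ :)
  exact ⟨⟨φ, ψ, c₁.map_comp_cancel (by rw [reassoc_of% hφ, hψ, Category.comp_id]),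
    c₂.map_comp_cancel (by rw [reassoc_of% hψ, hφ, Category.comp_id])⟩, hφ⟩

theorem autOver_eq_of_equiv (c₁ c₂ : GaloisCover X G) (h : c₁ ≈ c₂) :
    autOver c₁.map = autOver c₂.map := by
  obtain ⟨φ, hφ⟩ := h
  ext σ
  change σ.hom ≫ c₁.map = c₁.map ↔ σ.hom ≫ c₂.map = c₂.map
  rw [← hφ, ← Category.assoc, cancel_mono]

end

end CurveCovers

/-! ### Ramification -/

/-- Localization is formally unramified, so replacing the ring of `U` by its local ring at `f x`
does not affect the condition. -/
theorem formallyUnramified_stalkMap_iff {X Y : Scheme.{u}} {f : X ⟶ Y} {x : X} (U : Y.Opens)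
    (hU : IsAffineOpen U) (V : X.Opens) (hV : IsAffineOpen V) (hVU : V ≤ f ⁻¹ᵁ U)
    (hx : x ∈ V) :
    letI := (f.appLE U V hVU).hom.toAlgebra
    (f.stalkMap x).hom.FormallyUnramified ↔
      Algebra.IsUnramifiedAt Γ(Y, U) (hV.primeIdealOf ⟨x, hx⟩).asIdeal := by
  let := (f.appLE U V hVU).hom.toAlgebra
  let p := (hU.primeIdealOf ⟨f x, hVU hx⟩).asIdeal
  let q := (hV.primeIdealOf ⟨x, hx⟩).asIdeal
  have : q.LiesOver p :=
    ⟨congr($(IsAffineOpen.comap_primeIdealOf_appLE U hU V hV hVU hx).1).symm⟩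
  let := Localization.AtPrime.algebraOfLiesOver p q
  trans Algebra.FormallyUnramified (Localization.AtPrime p) (Localization.AtPrime q)
  · rw [← RingHom.formallyUnramified_algebraMap]
    exact RingHom.FormallyUnramified.respectsIso.arrow_mk_iso_iff
      (IsAffineOpen.arrowStalkMapIso f U hU V hV hVU hx)
  · have := Algebra.FormallyUnramified.of_isLocalization (Rₘ := Localization.AtPrime p)
      p.primeCompl
    exact ⟨fun _ ↦ Algebra.FormallyUnramified.comp Γ(Y, U) (Localization.AtPrime p) _,
      fun _ ↦ Algebra.FormallyUnramified.of_restrictScalars Γ(Y, U) _ _⟩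

theorem mem_primeIdealOf_iff {X : Scheme.{u}} {U : X.Opens} (hU : IsAffineOpen U) (x : U)
    (b : Γ(X, U)) : b ∈ (hU.primeIdealOf x).asIdeal ↔ x.1 ∉ X.basicOpen b := by
  rw [← not_iff_not, not_not, ← PrimeSpectrum.mem_basicOpen, ← hU.fromSpec_preimage_basicOpen]
  change hU.fromSpec (hU.primeIdealOf x) ∈ X.basicOpen b ↔ _
  rw [hU.fromSpec_primeIdealOf]

theorem primeIdealOf_injective {X : Scheme.{u}} {U : X.Opens} (hU : IsAffineOpen U) :
    Function.Injective hU.primeIdealOf := fun x y h ↦ by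
  rw [Subtype.ext_iff, ← hU.fromSpec_primeIdealOf, h, hU.fromSpec_primeIdealOf]

theorem isMaximal_primeIdealOf {X : Scheme.{u}} {U : X.Opens} (hU : IsAffineOpen U) (x : U)
    (hx : IsClosed {x.1}) : (hU.primeIdealOf x).asIdeal.IsMaximal := by
  rw [← PrimeSpectrum.isClosed_singleton_iff_isMaximal]
  convert! hx.preimage hU.fromSpec.continuous
  ext y
  change y = hU.primeIdealOf x ↔ hU.fromSpec y = x.1
  rw [← hU.fromSpec_primeIdealOf]
  exact hU.fromSpec.isOpenEmbedding.injective.eq_iff.symm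

theorem Algebra.FiniteType.bijective_algebraMap_quotient (k A : Type*) [Field k] [IsAlgClosed k]
    [CommRing A] [Algebra k A] [Algebra.FiniteType k A] (P : Ideal A) [P.IsMaximal] :
    Function.Bijective (algebraMap k (A ⧸ P)) := by
  let := Ideal.Quotient.field P
  have : Module.Finite k (A ⧸ P) := finite_of_finite_type_of_isJacobsonRing k (A ⧸ P)
  exact IsAlgClosed.algebraMap_bijective_of_isIntegral

theorem Algebra.FiniteType.perfectField_residueField (k A : Type*) [Field k] [IsAlgClosed k]
    [CommRing A] [Algebra k A] [Algebra.FiniteType k A] (P : Ideal A) [P.IsMaximal] :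
    PerfectField P.ResidueField :=
  .of_ringEquiv (RingEquiv.ofBijective ((algebraMap (A ⧸ P) P.ResidueField).comp
    (algebraMap k (A ⧸ P))) (P.bijective_algebraMap_quotient_residueField.comp
      (Algebra.FiniteType.bijective_algebraMap_quotient k A P)))

namespace CurveCovers

variable {k : Type u} [Field k]

open scoped Pointwise in
-- The action carries the prime of `x` to the prime of `σ x`, and a point of an affine open is
-- determined by its prime.
theorem stabilizer_primeIdealOf {X : Over (Spec (.of k))} {H : Subgroup (Aut X)}
    {U : X.left.Opens} (hU : IsStable H U) (hU' : IsAffineOpen U) (x : U) :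
    letI := sectionsAction hU
    MulAction.stabilizer H (hU'.primeIdealOf x).asIdeal = MulAction.stabilizer H x.1 := by
  let := sectionsAction hU
  ext σ
  have h : σ • (hU'.primeIdealOf x).asIdeal =
      (hU'.primeIdealOf ⟨σ.1.hom.left x.1, hU _ σ.2 x.2⟩).asIdeal := by
    ext b
    rw [Ideal.mem_pointwise_smul_iff_inv_smul_mem, sectionsAction_smul_eq]
    simp only [inv_inv, mem_primeIdealOf_iff]
    have := Scheme.basicOpen_appLE σ.1.hom.left U U (hU _ σ.2) b
    change _ ∉ X.left.basicOpen (σ.1.hom.left.appLE U U _ b) ↔ _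
    rw [this]
    exact not_congr (and_iff_right x.2)
  rw [MulAction.mem_stabilizer_iff, MulAction.mem_stabilizer_iff, h,
    ← PrimeSpectrum.ext_iff, (primeIdealOf_injective hU').eq_iff, Subtype.ext_iff]
  rfl

/-- On an affine open containing the image of `x`, the cover is Galois and, by the Nullstellensatz,
the residue field at `x` is `k`; the algebraic criterion then applies to the prime of `x`. -/
theorem ramificationLocus_eq_stabilizedLocus [IsAlgClosed k] {X : Over (Spec (.of k))}
    [IsSmoothProperCurve X] {G : Type*} [Group G] [Finite G] (c : GaloisCover X G) :
    ramificationLocus c.map.left = stabilizedLocus (autOver c.map) := by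
  ext x
  refine and_congr_right fun hx ↦ not_congr ?_
  obtain ⟨_, ⟨W, hW, rfl⟩, hxW, -⟩ := c.target.left.isBasis_affineOpens.exists_subset_of_mem_open
    (Set.mem_univ (c.map.left x)) isOpen_univ
  have hV := hW.preimage c.map.left
  let := sectionsAlgebraOfHom c.map W
  let := sectionsAction (isStable_preimage c.map le_rfl W)
  have hxV : x ∈ c.map.left ⁻¹ᵁ W := hxW
  have := isGaloisGroup_sections c hW ⟨_, hxW⟩
  have := c.finite_autOver
  have : Nonempty W := ⟨⟨_, hxW⟩⟩
  have : Nonempty (c.map.left ⁻¹ᵁ W) := ⟨⟨x, hxV⟩⟩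
  have := isDedekindDomain_sections c.target hW
  have := isDedekindDomain_sections X hV
  have := module_finite_sections c.map W hW
  have := faithfulSMul_sections c.map W
  have := sectionsAlgebraOfHom_isScalarTower c.map W
  have := finiteType_sections c.target hW
  have := finiteType_sections X hV
  let P := (hV.primeIdealOf ⟨x, hxV⟩).asIdeal
  have : P.IsMaximal := isMaximal_primeIdealOf hV ⟨x, hxV⟩ hx
  have : (P.under Γ(c.target.left, W)).IsMaximal := inferInstance
  have := Algebra.FiniteType.perfectField_residueField k Γ(c.target.left, W)
    (P.under Γ(c.target.left, W))
  rw [formallyUnramified_stalkMap_iff W hW _ hV le_rfl hxV]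
  refine (IsGaloisGroup.isUnramifiedAt_iff_stabilizer_eq_bot Γ(c.target.left, W)
    Γ(X.left, c.map.left ⁻¹ᵁ W) (autOver c.map) P ?_).trans ?_
  · refine .of_comp (g := algebraMap k Γ(c.target.left, W)) ?_
    rw [← RingHom.coe_comp, ← IsScalarTower.algebraMap_eq]
    exact (Algebra.FiniteType.bijective_algebraMap_quotient k _ P).2
  · rw [stabilizer_primeIdealOf]

end CurveCovers

/-! ### Gluing two charts -/

section

open Limits

/-- Two schemes can be glued along a common open subscheme. -/
theorem exists_gluing {V₁ V₂ W : Scheme.{u}} (i₁ : W ⟶ V₁) (i₂ : W ⟶ V₂) [IsOpenImmersion i₁]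
    [IsOpenImmersion i₂] {S : Scheme.{u}} (s₁ : V₁ ⟶ S) (s₂ : V₂ ⟶ S) (hs : i₁ ≫ s₁ = i₂ ≫ s₂) :
    ∃ (Y : Scheme.{u}) (j₁ : V₁ ⟶ Y) (j₂ : V₂ ⟶ Y) (y : Y ⟶ S) (_ : IsOpenImmersion j₁)
      (_ : IsOpenImmersion j₂), j₁.opensRange ⊔ j₂.opensRange = ⊤ ∧ i₁ ≫ j₁ = i₂ ≫ j₂ ∧
      (∀ x₁ x₂, j₁ x₁ = j₂ x₂ → ∃ w, i₁ w = x₁ ∧ i₂ w = x₂) ∧ j₁ ≫ y = s₁ ∧ j₂ ≫ y = s₂ := by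
  -- The glued scheme is the colimit of the span, a diagram of open immersions in which points of
  -- the two charts are identified only through `W`.
  let objs : Bool → Scheme.{u} := fun b ↦ b.rec V₂ V₁
  let arrows : ∀ b, W ⟶ objs b := fun b ↦ b.rec i₂ i₁
  let F : WidePushoutShape Bool ⥤ Scheme.{u} := WidePushoutShape.wideSpan W objs arrows
  have hF₁ : F.map (.init true) = i₁ := rfl
  have hF₂ : F.map (.init false) = i₂ := rfl
  have {i j} (f : i ⟶ j) : IsOpenImmersion (F.map f) := by
    rcases f with _ | (_ | _)
    · rw [WidePushoutShape.hom_id, F.map_id]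
      infer_instance
    · rwa [hF₂]
    · rwa [hF₁]
  have : Quiver.IsThin (WidePushoutShape Bool) := fun _ _ ↦ inferInstance
  let c : Cocone F := WidePushoutShape.mkCocone (F := F) (X := S) (i₁ ≫ s₁)
    (fun b ↦ b.rec s₂ s₁) (fun b ↦ b.rec hs.symm rfl)
  have w₁ : i₁ ≫ colimit.ι F (some true) = colimit.ι F none := colimit.w F (.init true)
  have w₂ : i₂ ≫ colimit.ι F (some false) = colimit.ι F none := colimit.w F (.init false)
  have h₁ : IsOpenImmersion (colimit.ι F (some true)) := inferInstance
  have h₂ : IsOpenImmersion (colimit.ι F (some false)) := inferInstance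
  refine ⟨colimit F, colimit.ι F (some true), colimit.ι F (some false), colimit.desc F c,
    h₁, h₂, ?_, w₁.trans w₂.symm, fun x₁ x₂ h ↦ ?_, colimit.ι_desc _ _,
    colimit.ι_desc _ _⟩
  · rw [eq_top_iff]
    rintro x -
    obtain ⟨i, x, rfl⟩ := Scheme.IsLocallyDirected.ι_jointly_surjective F x
    match i with
    | none =>
      refine .inl ⟨i₁ x, ?_⟩
      rw [← w₁]
      rfl
    | some true => exact .inl ⟨x, rfl⟩
    | some false => exact .inr ⟨x, rfl⟩
  · obtain ⟨l, fi, fj, x, h₁, h₂⟩ := (Scheme.IsLocallyDirected.ι_eq_ι_iff F).1 h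
    match l, fi, fj with
    | none, .init _, .init _ => exact ⟨x, h₁, h₂⟩

/-- A morphism out of a scheme covered by two open subschemes can be glued. -/
theorem exists_hom_of_sup_eq_top {X Y : Scheme.{u}} (U₁ U₂ : X.Opens) (hU : U₁ ⊔ U₂ = ⊤)
    (f₁ : U₁.toScheme ⟶ Y) (f₂ : U₂.toScheme ⟶ Y)
    (h : X.homOfLE (inf_le_left : U₁ ⊓ U₂ ≤ U₁) ≫ f₁ = X.homOfLE inf_le_right ≫ f₂) :
    ∃ f : X ⟶ Y, U₁.ι ≫ f = f₁ ∧ U₂.ι ≫ f = f₂ := by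
  let U : Bool → X.Opens := fun b ↦ b.rec U₂ U₁
  let g : ∀ b, (U b).toScheme ⟶ Y := fun b ↦ b.rec f₂ f₁
  have hU' : iSup U = ⊤ := by
    rw [iSup_bool_eq]
    exact hU
  let 𝒰 : X.OpenCover := X.openCoverOfIsOpenCover U hU'
  have h₁₂ : pullback.fst U₁.ι U₂.ι ≫ f₁ = pullback.snd U₁.ι U₂.ι ≫ f₂ := by
    have hp := isPullback_opens_inf U₁ U₂
    rw [← cancel_epi hp.isoPullback.hom, hp.isoPullback_hom_fst_assoc, hp.isoPullback_hom_snd_assoc,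
      h]
  have hg (a b : Bool) : pullback.fst (𝒰.f a) (𝒰.f b) ≫ g a =
      pullback.snd (𝒰.f a) (𝒰.f b) ≫ g b := by
    match a, b with
    | true, true =>
      have : pullback.fst U₁.ι U₁.ι = pullback.snd U₁.ι U₁.ι := by
        rw [← cancel_mono U₁.ι, pullback.condition]
      exact congr($this ≫ f₁)
    | false, false =>
      have : pullback.fst U₂.ι U₂.ι = pullback.snd U₂.ι U₂.ι := by
        rw [← cancel_mono U₂.ι, pullback.condition]
      exact congr($this ≫ f₂)
    | true, false => exact h₁₂
    | false, true =>
      have := congr((pullbackSymmetry U₂.ι U₁.ι).hom ≫ $h₁₂)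
      rw [pullbackSymmetry_hom_comp_fst_assoc, pullbackSymmetry_hom_comp_snd_assoc] at this
      exact this.symm
  exact ⟨𝒰.glueMorphisms g hg, 𝒰.ι_glueMorphisms g hg true, 𝒰.ι_glueMorphisms g hg false⟩

/-- Morphisms on the charts of a scheme covered by two open subschemes to the charts of a glued
scheme define a morphism, which pulls back charts to charts if it does so for their
intersection. -/
theorem exists_gluing_hom {X S : Scheme.{u}} (x : X ⟶ S) {U₁ U₂ : X.Opens} (hU : U₁ ⊔ U₂ = ⊤)
    {V₁ V₂ W : Scheme.{u}} (i₁ : W ⟶ V₁) (i₂ : W ⟶ V₂) [IsOpenImmersion i₁]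
    [IsOpenImmersion i₂] (s₁ : V₁ ⟶ S) (s₂ : V₂ ⟶ S) (hs : i₁ ≫ s₁ = i₂ ≫ s₂)
    (g₁ : U₁.toScheme ⟶ V₁) (g₂ : U₂.toScheme ⟶ V₂) (g : (U₁ ⊓ U₂).toScheme ⟶ W)
    (h₁ : X.homOfLE inf_le_left ≫ g₁ = g ≫ i₁) (h₂ : X.homOfLE inf_le_right ≫ g₂ = g ≫ i₂)
    (hr₁ : ∀ u, g₁ u ∈ i₁.opensRange → u.1 ∈ U₂) (hr₂ : ∀ u, g₂ u ∈ i₂.opensRange → u.1 ∈ U₁)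
    (hs₁ : g₁ ≫ s₁ = U₁.ι ≫ x) (hs₂ : g₂ ≫ s₂ = U₂.ι ≫ x) :
    ∃ (Y : Scheme.{u}) (f : X ⟶ Y) (j₁ : V₁ ⟶ Y) (j₂ : V₂ ⟶ Y) (y : Y ⟶ S)
      (_ : IsOpenImmersion j₁) (_ : IsOpenImmersion j₂), j₁.opensRange ⊔ j₂.opensRange = ⊤ ∧
      IsPullback g₁ U₁.ι j₁ f ∧ IsPullback g₂ U₂.ι j₂ f ∧ j₁ ≫ y = s₁ ∧ j₂ ≫ y = s₂ ∧
      f ≫ y = x := by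
  obtain ⟨Y, j₁, j₂, y, _, _, hY, hj, hj', hy₁, hy₂⟩ := exists_gluing i₁ i₂ s₁ s₂ hs
  obtain ⟨f, hf₁, hf₂⟩ := exists_hom_of_sup_eq_top U₁ U₂ hU (g₁ ≫ j₁) (g₂ ≫ j₂) (by
    rw [reassoc_of% h₁, reassoc_of% h₂, hj])
  have hf₁' (u : U₁) : f u.1 = j₁ (g₁ u) := congr($hf₁ u)
  have hf₂' (u : U₂) : f u.1 = j₂ (g₂ u) := congr($hf₂ u)
  refine ⟨Y, f, j₁, j₂, y, ‹_›, ‹_›, hY, IsOpenImmersion.isPullback _ _ _ _ hf₁ ?_,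
    IsOpenImmersion.isPullback _ _ _ _ hf₂ ?_, hy₁, hy₂, ?_⟩
  · rw [Scheme.Opens.opensRange_ι]
    ext z
    refine ⟨?_, fun hz ↦ ⟨g₁ ⟨z, hz⟩, (hf₁' ⟨z, hz⟩).symm⟩⟩
    rintro ⟨v, hv⟩
    obtain hz | hz := (hU.ge (Set.mem_univ z) : z ∈ U₁ ⊔ U₂)
    · exact hz
    · obtain ⟨w, -, hw⟩ := hj' v (g₂ ⟨z, hz⟩) (hv.trans (hf₂' ⟨z, hz⟩))
      exact hr₂ ⟨z, hz⟩ ⟨w, hw⟩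
  · rw [Scheme.Opens.opensRange_ι]
    ext z
    refine ⟨?_, fun hz ↦ ⟨g₂ ⟨z, hz⟩, (hf₂' ⟨z, hz⟩).symm⟩⟩
    rintro ⟨v, hv⟩
    obtain hz | hz := (hU.ge (Set.mem_univ z) : z ∈ U₁ ⊔ U₂)
    · obtain ⟨w, hw, -⟩ := hj' (g₁ ⟨z, hz⟩) v ((hf₁' ⟨z, hz⟩).symm.trans hv.symm)
      exact hr₁ ⟨z, hz⟩ ⟨w, hw⟩
    · exact hz
  · refine Scheme.hom_ext_of_forall _ _ fun z ↦ ?_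
    obtain hz | hz := (hU.ge (Set.mem_univ z) : z ∈ U₁ ⊔ U₂)
    · exact ⟨U₁, hz, by rw [reassoc_of% hf₁, hy₁, hs₁]⟩
    · exact ⟨U₂, hz, by rw [reassoc_of% hf₂, hy₂, hs₂]⟩

end

/-! ### Loci of regularity of rational functions -/

section

variable {X : Scheme.{u}} [IsIntegral X]

/-- The open subscheme of points at which a rational function is regular. -/
noncomputable def regularLocus (a : X.functionField) : X.Opens :=
  sSup {V | ∃ (h : genericPoint X ∈ V) (s : Γ(X, V)), X.presheaf.germ V _ h s = a}

theorem genericPoint_mem_of_nonempty {V : X.Opens} (hV : (V : Set X).Nonempty) :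
    genericPoint X ∈ V :=
  ((genericPoint_spec X).mem_open_set_iff V.isOpen).2 (by simpa using hV)

theorem le_regularLocus {V : X.Opens} (h : genericPoint X ∈ V) (s : Γ(X, V)) :
    V ≤ regularLocus (X.presheaf.germ V _ h s) :=
  le_sSup ⟨h, s, rfl⟩

theorem genericPoint_mem_regularLocus (a : X.functionField) : genericPoint X ∈ regularLocus a := by
  obtain ⟨V, h, s, rfl⟩ := X.presheaf.exists_germ_eq a
  exact le_regularLocus h s h

/-- Sections with generic germ `a` agree on overlaps because `X` is integral, so they glue. -/
theorem exists_germ_regularLocus_eq (a : X.functionField) :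
    ∃ s : Γ(X, regularLocus a),
      X.presheaf.germ _ _ (genericPoint_mem_regularLocus a) s = a := by
  let ι := {V : X.Opens | ∃ (h : genericPoint X ∈ V) (s : Γ(X, V)), X.presheaf.germ V _ h s = a}
  choose h s hs using fun i : ι ↦ i.2
  obtain ⟨t, ht, -⟩ := X.sheaf.existsUnique_gluing' (fun i : ι ↦ i.1) (regularLocus a)
    (fun i ↦ homOfLE (le_sSup i.2)) (sSup_eq_iSup' _).le s fun i j ↦
      germ_injective_of_isIntegral X (U := i.1 ⊓ j.1) (genericPoint X) ⟨h i, h j⟩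
        ((((X.presheaf.germ_res_apply _ _ _ _).trans (hs i)).trans (hs j).symm).trans
          (X.presheaf.germ_res_apply _ _ _ _).symm)
  obtain ⟨V, hV, s', hs'⟩ := X.presheaf.exists_germ_eq a
  let i : ι := ⟨V, hV, s', hs'⟩
  exact ⟨t, (X.presheaf.germ_res_apply (homOfLE (le_sSup i.2)) _ (h i) t).symm.trans
    ((congrArg (X.presheaf.germ _ _ (h i)) (ht i)).trans (hs i))⟩

theorem mem_regularLocus_of_stalk {a : X.functionField} {x : X} (r : X.presheaf.stalk x)
    (h : algebraMap _ X.functionField r = a) : x ∈ regularLocus a := by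
  obtain ⟨V, hx, s, rfl⟩ := X.presheaf.exists_germ_eq r
  have hV := genericPoint_mem_of_nonempty ⟨x, hx⟩
  have : Nonempty V := ⟨⟨x, hx⟩⟩
  rw [X.algebraMap_germ_eq_germToFunctionField hx] at h
  subst h
  exact le_regularLocus hV s hx

/-- A valuation ring contains `a` or `a⁻¹`. -/
theorem regularLocus_sup_regularLocus_inv (a : X.functionField)
    (h : ∀ x : X, ValuationRing (X.presheaf.stalk x)) :
    regularLocus a ⊔ regularLocus a⁻¹ = ⊤ := by
  rw [eq_top_iff]
  rintro x -
  obtain ⟨r, hr⟩ | ⟨r, hr⟩ := ValuationRing.isInteger_or_isInteger (X.presheaf.stalk x) a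
  · exact .inl (mem_regularLocus_of_stalk r hr)
  · exact .inr (mem_regularLocus_of_stalk r hr)

/-- Where both functions are regular their product is `1`, so `s` is a unit; where `s` is a unit,
its inverse extends `a⁻¹`. -/
theorem regularLocus_inf_regularLocus_inv {a : X.functionField} (ha : a ≠ 0)
    {s : Γ(X, regularLocus a)}
    (hs : X.presheaf.germ _ _ (genericPoint_mem_regularLocus a) s = a) :
    regularLocus a ⊓ regularLocus a⁻¹ = X.basicOpen s := by
  have hη := genericPoint_mem_regularLocus a
  obtain ⟨s', hs'⟩ := exists_germ_regularLocus_eq a⁻¹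
  refine le_antisymm (fun x hx ↦ ?_) fun x hx ↦ ⟨X.basicOpen_le s hx, ?_⟩
  · rw [Scheme.mem_basicOpen _ _ _ hx.1]
    have h : X.presheaf.map (homOfLE inf_le_left).op s * X.presheaf.map (homOfLE inf_le_right).op s'
        = (1 : Γ(X, regularLocus a ⊓ regularLocus a⁻¹)) := by
      have hm : genericPoint X ∈ regularLocus a ⊓ regularLocus a⁻¹ :=
        ⟨hη, genericPoint_mem_regularLocus a⁻¹⟩
      refine germ_injective_of_isIntegral X _ hm ?_
      rw [map_mul, map_one, X.presheaf.germ_res_apply, X.presheaf.germ_res_apply, hs, hs',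
        mul_inv_cancel₀ ha]
    have h' := congr(X.presheaf.germ _ x hx $h)
    rw [map_mul, map_one, X.presheaf.germ_res_apply] at h'
    exact .of_mul_eq_one _ h'
  · have hη' : genericPoint X ∈ X.basicOpen s := genericPoint_mem_of_nonempty ⟨x, hx⟩
    obtain ⟨v, hv⟩ : ∃ v, X.presheaf.map (homOfLE (X.basicOpen_le s)).op s * v =
        (1 : Γ(X, X.basicOpen s)) := (RingedSpace.isUnit_res_basicOpen X.toRingedSpace s).exists_right_inv
    have : X.presheaf.germ _ _ hη' v = a⁻¹ := by
      have h := congr(X.presheaf.germ _ _ hη' $hv)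
      rw [map_mul, map_one] at h
      refine eq_inv_of_mul_eq_one_right ?_
      rwa [X.presheaf.germ_res_apply, hs] at h
    rw [← this]
    exact le_regularLocus hη' _ hx

end

/-! ### Stability of the regular locus of an invariant function -/

namespace CurveCovers

variable {k : Type u} [Field k] {X : Over (Spec (.of k))}

theorem map_sectionsMap {Y : Over (Spec (.of k))} (f : X ⟶ Y) {U : Y.left.Opens}
    {V V' : X.left.Opens} (h : V ≤ f.left ⁻¹ᵁ U) (h' : V' ≤ V) (s : Γ(Y.left, U)) :
    X.left.presheaf.map (homOfLE h').op (sectionsMap f U V h s) =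
      sectionsMap f U V' (h'.trans h) s :=
  congr($(Scheme.Hom.appLE_map f.left h (homOfLE h').op) s)

theorem sectionsMap_map {Y : Over (Spec (.of k))} (f : X ⟶ Y) {U U' : Y.left.Opens}
    {V : X.left.Opens} (h : V ≤ f.left ⁻¹ᵁ U) (h' : U ≤ U') (s : Γ(Y.left, U')) :
    sectionsMap f U V h (Y.left.presheaf.map (homOfLE h').op s) =
      sectionsMap f U' V (h.trans fun _ hx ↦ h' hx) s :=
  congr($(Scheme.Hom.map_appLE f.left h (homOfLE h').op) s)

section

variable [IsIntegral X.left] {H : Subgroup (Aut X)} {U : X.left.Opens}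

/-- Invariance of a rational function does not depend on the open set representing it: `s` and `t`
agree on `V ⊓ U`, and pulling back this equality gives the claim. -/
theorem germ_sectionsMap_eq_of_germ_eq (hU : IsStable H U)
    (hη : genericPoint X.left ∈ U) {t : Γ(X.left, U)}
    (ht : ∀ (σ) (hσ : σ ∈ H), sectionsMap σ.hom U U (hU σ hσ) t = t)
    {V : X.left.Opens} (hV : genericPoint X.left ∈ V)
    {s : Γ(X.left, V)}
    (hs : X.left.presheaf.germ _ _ hV s = X.left.presheaf.germ _ _ hη t) (σ) (hσ : σ ∈ H)
    {W : X.left.Opens} (hW : genericPoint X.left ∈ W) (hWV : W ≤ σ.hom.left ⁻¹ᵁ V) :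
    X.left.presheaf.germ _ _ hW (sectionsMap σ.hom V W hWV s) =
      X.left.presheaf.germ _ _ hη t := by
  have hle : W ⊓ U ≤ σ.hom.left ⁻¹ᵁ (V ⊓ U) := fun x hx ↦ ⟨hWV hx.1, hU σ hσ hx.2⟩
  have h₁ : X.left.presheaf.map (homOfLE inf_le_left).op s =
      (X.left.presheaf.map (homOfLE inf_le_right).op t : Γ(X.left, V ⊓ U)) := by
    have hm : genericPoint X.left ∈ V ⊓ U := ⟨hV, hη⟩
    refine germ_injective_of_isIntegral X.left _ hm ?_
    rw [X.left.presheaf.germ_res_apply, X.left.presheaf.germ_res_apply, hs]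
  have h₂ := congr(sectionsMap σ.hom (V ⊓ U) (W ⊓ U) hle $h₁)
  rw [sectionsMap_map, sectionsMap_map, ← map_sectionsMap σ.hom hWV inf_le_left,
    ← map_sectionsMap σ.hom (hU σ hσ) inf_le_right, ht σ hσ] at h₂
  have hm : genericPoint X.left ∈ W ⊓ U := ⟨hW, hη⟩
  have h₃ := congr(X.left.presheaf.germ (W ⊓ U) (genericPoint X.left) hm $h₂)
  rwa [X.left.presheaf.germ_res_apply, X.left.presheaf.germ_res_apply] at h₃

instance isIso_aut_hom_left (σ : Aut X) : IsIso σ.hom.left :=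
  have : IsIso σ.hom := Iso.isIso_hom (show X ≅ X from σ)
  inferInstanceAs (IsIso ((Over.forget _).map σ.hom))

theorem genericPoint_mem_preimage (σ : Aut X) {V : X.left.Opens} (hV : genericPoint X.left ∈ V) :
    genericPoint X.left ∈ σ.hom.left ⁻¹ᵁ V := by
  have := map_genericPoint σ.hom.left
  rwa [← this] at hV

theorem isStable_regularLocus (hU : IsStable H U)
    (hη : genericPoint X.left ∈ U) {t : Γ(X.left, U)}
    (ht : ∀ (σ) (hσ : σ ∈ H), sectionsMap σ.hom U U (hU σ hσ) t = t) :
    IsStable H (regularLocus (X.left.presheaf.germ _ _ hη t)) := by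
  -- Pulling back the section that represents the function gives one with the same germ, so the
  -- preimage of the regular locus lies inside it. Stability is this inclusion for `σ⁻¹`.
  have key (σ) (hσ : σ ∈ H) : σ.hom.left ⁻¹ᵁ regularLocus (X.left.presheaf.germ _ _ hη t) ≤
      regularLocus (X.left.presheaf.germ _ _ hη t) := by
    obtain ⟨s, hs⟩ := exists_germ_regularLocus_eq (X.left.presheaf.germ _ _ hη t)
    have hV := genericPoint_mem_regularLocus (X.left.presheaf.germ _ _ hη t)
    have := germ_sectionsMap_eq_of_germ_eq hU hη ht hV hs σ hσ
      (genericPoint_mem_preimage σ hV) le_rfl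
    have h := le_regularLocus (genericPoint_mem_preimage σ hV)
      (sectionsMap σ.hom _ (σ.hom.left ⁻¹ᵁ _) le_rfl s)
    rwa [this] at h
  intro σ hσ x hx
  refine key σ⁻¹ (H.inv_mem hσ) ?_
  have : (σ⁻¹).hom.left (σ.hom.left x) = x := inv_smul_smul σ x
  rwa [← this] at hx

theorem sectionsMap_eq_of_germ_eq (hU : IsStable H U)
    (hη : genericPoint X.left ∈ U) {t : Γ(X.left, U)}
    (ht : ∀ (σ) (hσ : σ ∈ H), sectionsMap σ.hom U U (hU σ hσ) t = t)
    {s : Γ(X.left, regularLocus (X.left.presheaf.germ _ _ hη t))}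
    (hs : X.left.presheaf.germ _ _ (genericPoint_mem_regularLocus _) s =
      X.left.presheaf.germ _ _ hη t) (σ) (hσ : σ ∈ H) :
    sectionsMap σ.hom _ _ (isStable_regularLocus hU hη ht σ hσ) s = s :=
  germ_injective_of_isIntegral X.left (genericPoint X.left) (genericPoint_mem_regularLocus _)
    ((germ_sectionsMap_eq_of_germ_eq hU hη ht _ hs σ hσ _ _).trans hs.symm)

end

end CurveCovers

/-- A nonconstant map from an affine curve to the affine line has finite fibres. -/
theorem IsDedekindDomain.finite_preimage_comap_singleton {k B : Type*} [Field k] [IsAlgClosed k]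
    [CommRing B] [IsDedekindDomain B] [Algebra k B] [Algebra.FiniteType k B]
    (φ : Polynomial k →ₐ[k] B) (hφ : Function.Injective φ) (p : PrimeSpectrum (Polynomial k)) :
    (PrimeSpectrum.comap φ.toRingHom ⁻¹' {p}).Finite := by
  by_cases hp : p.asIdeal = ⊥
  · refine Set.Finite.subset (Set.finite_singleton ⊥) fun q hq ↦ ?_
    by_contra! h
    have hq0 : q.asIdeal ≠ ⊥ := fun h' ↦ h (PrimeSpectrum.ext h')
    have : q.asIdeal.IsMaximal := q.2.isMaximal hq0
    obtain ⟨c, hc⟩ := (Algebra.FiniteType.bijective_algebraMap_quotient k B q.asIdeal).2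
      (Ideal.Quotient.mk _ (φ .X))
    have hmem : φ (.X - .C c) ∈ q.asIdeal := by
      rw [map_sub, ← Polynomial.algebraMap_eq, AlgHom.commutes, ← Ideal.Quotient.eq_zero_iff_mem,
        map_sub, ← hc, sub_eq_zero]
      rfl
    have hmem' : (Polynomial.X - .C c) ∈ p.asIdeal := by
      rw [← hq]
      exact hmem
    rw [hp] at hmem'
    exact Polynomial.X_sub_C_ne_zero c hmem'
  · obtain ⟨g, hg, hg0⟩ := Submodule.exists_mem_ne_zero_of_ne_bot hp
    have hφg : φ g ≠ 0 := by
      rwa [Ne, map_eq_zero_iff _ hφ]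
    -- Primes in the fibre over a nonzero `p` divide the nonzero ideal generated by `φ g`.
    have hfin := Ideal.finite_factors (I := Ideal.span {φ g}) (by simpa using hφg)
    refine ((hfin.image fun v ↦ (⟨v.asIdeal, v.isPrime⟩ : PrimeSpectrum B))).subset fun q hq ↦ ?_
    have hgq : φ g ∈ q.asIdeal := by
      have : g ∈ (PrimeSpectrum.comap φ.toRingHom q).asIdeal := by rwa [hq]
      exact this
    have hq0 : q.asIdeal ≠ ⊥ := fun h ↦ hφg (by rwa [h] at hgq)
    refine ⟨⟨q.asIdeal, q.2, hq0⟩, ?_, rfl⟩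
    simpa [Ideal.dvd_span_singleton] using hgq

/-! ### Quasi-finite maps to the affine line -/

namespace CurveCovers

variable {k : Type u} [Field k]

/-- The morphism to the affine line defined by a global section. -/
noncomputable def toAffineLine (Z : Over (Spec (.of k))) (τ : Γ(Z.left, ⊤)) :
    Z.left ⟶ Spec (.of (Polynomial k)) :=
  Z.left.toSpecΓ ≫ Spec.map (CommRingCat.ofHom (Polynomial.aeval (R := k) τ).toRingHom)

/-- The structure morphism factors through the spectrum of the algebra of global sections. -/
theorem toSpecΓ_SpecMap_algebraMap (Z : Over (Spec (.of k))) :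
    Z.left.toSpecΓ ≫ Spec.map (CommRingCat.ofHom (algebraMap k Γ(Z.left, ⊤))) = Z.hom := by
  have : CommRingCat.ofHom (algebraMap k Γ(Z.left, ⊤)) =
      (Scheme.ΓSpecIso (.of k)).inv ≫ Z.hom.appTop :=
    congr((Scheme.ΓSpecIso (.of k)).inv ≫ $(Scheme.Hom.appLE_eq_app Z.hom (U := ⊤)))
  rw [this, Spec.map_comp, ← Scheme.toSpecΓ_naturality_assoc, toSpecΓ_SpecMap_ΓSpecIso_inv]
  exact Category.comp_id _

theorem toAffineLine_comp (Z : Over (Spec (.of k))) (τ : Γ(Z.left, ⊤)) :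
    toAffineLine Z τ ≫ Spec.map (CommRingCat.ofHom (algebraMap k (Polynomial k))) = Z.hom := by
  rw [toAffineLine, Category.assoc, ← Spec.map_comp, ← toSpecΓ_SpecMap_algebraMap Z]
  congr 3
  ext c
  exact (Polynomial.aeval (R := k) τ).commutes c

theorem fromSpec_toAffineLine (Z : Over (Spec (.of k))) (τ : Γ(Z.left, ⊤)) {V : Z.left.Opens}
    (hV : IsAffineOpen V) : hV.fromSpec ≫ toAffineLine Z τ =
      Spec.map (CommRingCat.ofHom (Polynomial.aeval (R := k)
        (Z.left.presheaf.map (homOfLE le_top).op τ : Γ(Z.left, V))).toRingHom) := by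
  rw [toAffineLine, hV.fromSpec_toSpecΓ_assoc, ← Spec.map_comp]
  congr 1
  have := Polynomial.aeval_algHom (sectionsMap (𝟙 Z) ⊤ V le_top) τ
  have h : Z.left.presheaf.map (homOfLE le_top).op = (𝟙 Z.left : Z.left ⟶ Z.left).appLE ⊤ V le_top := by
    simp [Scheme.Hom.appLE]
  rw [h]
  refine CommRingCat.hom_ext (RingHom.ext fun c ↦ ?_)
  exact congr($this c).symm

/-- As `k` is algebraically closed, a nonconstant function is transcendental; so `k[X]` embeds in
each affine coordinate ring, and the fibres are finite. -/
theorem locallyQuasiFinite_toAffineLine [IsAlgClosed k] (Z : Over (Spec (.of k)))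
    [IsIntegral Z.left] [LocallyOfFiniteType Z.hom]
    (hZ : ∀ V : Z.left.Opens, IsAffineOpen V → Nonempty V → IsDedekindDomain Γ(Z.left, V))
    (τ : Γ(Z.left, ⊤)) (hτ : ∀ c, algebraMap k _ c ≠ τ) :
    LocallyQuasiFinite (toAffineLine Z τ) := by
  have : LocallyOfFiniteType (toAffineLine Z τ ≫
      Spec.map (CommRingCat.ofHom (algebraMap k (Polynomial k)))) := by
    rwa [toAffineLine_comp]
  have := locallyOfFiniteType_of_comp (toAffineLine Z τ)
    (Spec.map (CommRingCat.ofHom (algebraMap k (Polynomial k))))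
  have : IsZariskiLocalAtSource @LocallyQuasiFinite.{u} :=
    HasRingHomProperty.instIsZariskiLocalAtSource (Q := RingHom.QuasiFinite)
  rw [IsZariskiLocalAtSource.iff_of_iSup_eq_top (P := @LocallyQuasiFinite) _
    (iSup_affineOpens_eq_top Z.left)]
  suffices h : ∀ V : Z.left.Opens, IsAffineOpen V → LocallyQuasiFinite (V.ι ≫ toAffineLine Z τ) from
    fun V ↦ h V.1 V.2
  intro V hV
  obtain hV' | hV' := isEmpty_or_nonempty V
  · exact .of_finite_preimage_singleton _ fun x ↦ Set.toFinite _
  have hs := hV.toSpecΓ_fromSpec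
  rw [← hs, Category.assoc, fromSpec_toAffineLine, ← hV.isoSpec_hom]
  have := hZ V hV hV'
  have := finiteType_sections Z hV
  have hinj : Function.Injective (Polynomial.aeval (R := k)
        (Z.left.presheaf.map (homOfLE le_top).op τ : Γ(Z.left, V))) := by
    rw [← transcendental_iff_injective]
    intro h
    obtain ⟨c, hc⟩ := IsIntegral.exists_algebraMap_eq_of_isAlgClosed h.isIntegral
    refine hτ c (map_injective_of_isIntegral Z.left (homOfLE le_top : V ⟶ ⊤) ?_)
    rw [← hc]
    have h : Z.left.presheaf.map (homOfLE le_top).op = (𝟙 Z.left : Z.left ⟶ Z.left).appLE ⊤ V le_top := by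
      simp [Scheme.Hom.appLE]
    rw [h]
    exact congr($(algebraMap_sections_comp_appLE (𝟙 Z) ⊤ V le_top) c)
  have : LocallyQuasiFinite (Spec.map (CommRingCat.ofHom (Polynomial.aeval (R := k)
        (Z.left.presheaf.map (homOfLE le_top).op τ : Γ(Z.left, V))).toRingHom)) := by
    have : LocallyOfFiniteType (Spec.map (CommRingCat.ofHom (Polynomial.aeval (R := k)
        (Z.left.presheaf.map (homOfLE le_top).op τ : Γ(Z.left, V))).toRingHom)) := by
      rw [← fromSpec_toAffineLine Z τ hV]
      infer_instance
    exact .of_finite_preimage_singleton _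
      (IsDedekindDomain.finite_preimage_comap_singleton _ hinj)
  infer_instance

end CurveCovers

/-- Every point of the spectrum of a local ring specializes to the closed point, so its image lies
in any open set containing the image of the closed point. -/
theorem AlgebraicGeometry.exists_comp_ι_eq_of_closedPoint_mem {R : Type u} [CommRing R]
    [IsLocalRing R] {X : Scheme.{u}} (l : Spec (.of R) ⟶ X) {U : X.Opens}
    (h : l (IsLocalRing.closedPoint R) ∈ U) : ∃ l' : Spec (.of R) ⟶ U, l' ≫ U.ι = l := by
  refine ⟨IsOpenImmersion.lift U.ι l ?_, IsOpenImmersion.lift_fac _ _ _⟩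
  rintro _ ⟨y, rfl⟩
  rw [Scheme.Opens.range_ι]
  exact ((IsLocalRing.specializes_closedPoint y).map l.continuous).mem_open U.2 h

theorem AlgebraicGeometry.appTop_SpecMap_injective {R S : CommRingCat.{u}} {a : R ⟶ S}
    (ha : Function.Injective a.hom) : Function.Injective (Spec.map a).appTop := by
  intro r s h
  obtain ⟨r, rfl⟩ := (Scheme.ΓSpecIso R).commRingCatIsoToRingEquiv.symm.surjective r
  obtain ⟨s, rfl⟩ := (Scheme.ΓSpecIso R).commRingCatIsoToRingEquiv.symm.surjective s
  have h (r : R) : (Spec.map a).appTop ((Scheme.ΓSpecIso R).inv r) = (Scheme.ΓSpecIso S).inv (a r) :=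
    congr($(Scheme.ΓSpecIso_inv_naturality a) r).symm
  congr 1
  refine ha ((Scheme.ΓSpecIso S).commRingCatIsoToRingEquiv.symm.injective ?_)
  exact (h r).symm.trans (‹_ = _›.trans (h s))

theorem AlgebraicGeometry.eq_of_SpecMap_comp_eq {R S A : CommRingCat.{u}} {a : R ⟶ S}
    (ha : Function.Injective a.hom) {f g : Spec R ⟶ Spec A}
    (h : Spec.map a ≫ f = Spec.map a ≫ g) : f = g := by
  obtain ⟨f, rfl⟩ := Spec.map_surjective f
  obtain ⟨g, rfl⟩ := Spec.map_surjective g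
  rw [← Spec.map_comp, ← Spec.map_comp, Spec.map_inj] at h
  congr 1
  ext r
  exact ha congr($h r)

/-! ### Affineness of the locus where a function is regular -/

namespace CurveCovers

variable {k : Type u} [Field k]

theorem toAffineLine_appTop (Z : Over (Spec (.of k))) (τ : Γ(Z.left, ⊤)) :
    (toAffineLine Z τ).appTop ((Scheme.ΓSpecIso (.of (Polynomial k))).inv Polynomial.X) = τ := by
  let φ := (Polynomial.aeval (R := k) τ).toRingHom
  have h₁ := congr($(Scheme.Hom.comp_appTop Z.left.toSpecΓ (Spec.map (CommRingCat.ofHom φ)))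
    ((Scheme.ΓSpecIso (.of (Polynomial k))).inv Polynomial.X))
  refine h₁.trans ?_
  rw [Scheme.toSpecΓ_appTop]
  refine (congrArg (Scheme.ΓSpecIso Γ(Z.left, ⊤)).hom
    congr($(Scheme.ΓSpecIso_inv_naturality (CommRingCat.ofHom φ)) Polynomial.X).symm).trans ?_
  refine ((Scheme.ΓSpecIso Γ(Z.left, ⊤)).commRingCatIsoToRingEquiv.apply_symm_apply
    (φ Polynomial.X)).trans ?_
  exact Polynomial.aeval_X _

/-- The open subscheme on which a rational function is regular maps to the affine line by a
universally closed morphism. -/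
theorem universallyClosed_toAffineLine (X : Over (Spec (.of k))) [UniversallyClosed X.hom]
    {U₁ U₂ : X.left.Opens} [CompactSpace U₁] (hU : U₁ ⊔ U₂ = ⊤) (τ₁ : Γ(X.left, U₁))
    (τ₂ : Γ(X.left, U₂)) (hτ₂ : X.left.basicOpen τ₂ ≤ U₁)
    (hτ : X.left.presheaf.map (homOfLE inf_le_left).op τ₁ *
      X.left.presheaf.map (homOfLE inf_le_right).op τ₂ = (1 : Γ(X.left, U₁ ⊓ U₂))) :
    UniversallyClosed (toAffineLine (Over.mk (U₁.ι ≫ X.hom)) (U₁.ι.appLE U₁ ⊤ (by simp) τ₁)) := by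
  set Z : Over (Spec (.of k)) := Over.mk (U₁.ι ≫ X.hom)
  set τ : Γ(Z.left, ⊤) := U₁.ι.appLE U₁ ⊤ (by simp) τ₁
  set h := toAffineLine Z τ
  have : QuasiCompact h := by
    rw [quasiCompact_iff_compactSpace]
    assumption
  refine .of_valuativeCriterion _ fun S ↦ ?_
  obtain ⟨R, K, i₁, i₂, ⟨hi⟩⟩ := S
  dsimp only at i₁ i₂ hi ⊢
  let a := CommRingCat.ofHom (algebraMap R K)
  have ha : Function.Injective a.hom := FaithfulSMul.algebraMap_injective R K
  let i₁' : Spec (.of K) ⟶ U₁ := i₁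
  have hex : ValuativeCriterion.Existence X.hom := by
    have : UniversallyClosed X.hom := inferInstance
    rw [UniversallyClosed.eq_valuativeCriterion] at this
    exact this.1
  have hcomm : (i₁' ≫ U₁.ι) ≫ X.hom = Spec.map a ≫ i₂ ≫
      Spec.map (CommRingCat.ofHom (algebraMap k (Polynomial k))) := by
    rw [← reassoc_of% hi, toAffineLine_comp Z τ]
    exact Category.assoc _ _ _
  -- Universal closedness of `X` extends the point to the valuation ring; what remains is that the
  -- extension stays in `U₁`.
  obtain ⟨l, hl₁, hl₂⟩ := (hex ⟨R, K, i₁' ≫ U₁.ι, i₂ ≫ Spec.map (CommRingCat.ofHom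
    (algebraMap k (Polynomial k))), ⟨hcomm⟩⟩).exists_lift
  dsimp only at l hl₁ hl₂
  have hmem : l (IsLocalRing.closedPoint R) ∈ U₁ := by
    -- Otherwise the extension lies in `U₂`. Then `r₂` (from `τ₂`) and `r₁` (from the coordinate of
    -- the affine line) have product `1` over `K`, hence over `R`; so `r₂` is a unit and the closed
    -- point lands in the basic open set of `τ₂`, inside `U₁`.
    by_contra hx
    have hx₂ : l (IsLocalRing.closedPoint R) ∈ U₂ :=
      ((hU.ge (Set.mem_univ (l (IsLocalRing.closedPoint R))) : _ ∈ U₁ ⊔ U₂)).resolve_left hx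
    have hle : ⊤ ≤ l ⁻¹ᵁ U₂ := fun y _ ↦
      ((IsLocalRing.specializes_closedPoint y).map l.continuous).mem_open U₂.2 hx₂
    have hle₁ : ⊤ ≤ (i₁' ≫ U₁.ι) ⁻¹ᵁ U₁ := fun y _ ↦ (i₁' y).2
    have hle₂ : ⊤ ≤ (i₁' ≫ U₁.ι) ⁻¹ᵁ U₂ := by
      rw [← hl₁]
      exact fun y _ ↦ hle (Set.mem_univ _)
    have hle₁₂ : ⊤ ≤ (i₁' ≫ U₁.ι) ⁻¹ᵁ (U₁ ⊓ U₂) := fun y hy ↦ ⟨hle₁ hy, hle₂ hy⟩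
    let r₂ : Γ(Spec (.of R), ⊤) := l.appLE U₂ ⊤ hle τ₂
    let T : Γ(Spec (.of (Polynomial k)), ⊤) := (Scheme.ΓSpecIso (.of (Polynomial k))).inv Polynomial.X
    let r₁ : Γ(Spec (.of R), ⊤) := i₂.appTop T
    have hT : h.appTop T = τ := toAffineLine_appTop Z τ
    have h₁ : (Spec.map a).appTop r₁ = (i₁' ≫ U₁.ι).appLE U₁ ⊤ hle₁ τ₁ := by
      refine congr($((Scheme.Hom.comp_appTop (Spec.map a) i₂).symm) T).trans ?_
      rw [← hi]
      refine congr($(Scheme.Hom.comp_appTop i₁ h) T).trans ?_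
      refine (congrArg i₁.appTop hT).trans ?_
      exact congr($(Scheme.Hom.appLE_comp_appLE i₁' U₁.ι U₁ ⊤ ⊤ (by simp) le_rfl) τ₁)
    have h₂ : (Spec.map a).appTop r₂ = (i₁' ≫ U₁.ι).appLE U₂ ⊤ hle₂ τ₂ := by
      simp only [← hl₁]
      exact congr($(Scheme.Hom.appLE_comp_appLE (Spec.map a) l U₂ ⊤ ⊤ hle le_rfl) τ₂)
    have h₃ : r₁ * r₂ = 1 := by
      refine appTop_SpecMap_injective ha ?_
      rw [map_mul, map_one, h₁, h₂]
      have := congr((i₁' ≫ U₁.ι).appLE (U₁ ⊓ U₂) ⊤ hle₁₂ $hτ)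
      rw [map_mul, map_one] at this
      rw [← this]
      congr 1
      · exact congr($(Scheme.Hom.map_appLE (i₁' ≫ U₁.ι) hle₁₂ (homOfLE inf_le_left).op) τ₁).symm
      · exact congr($(Scheme.Hom.map_appLE (i₁' ≫ U₁.ι) hle₁₂ (homOfLE inf_le_right).op) τ₂).symm
    have h₄ : IsLocalRing.closedPoint R ∈ (Spec (.of R)).basicOpen r₂ := by
      rw [Scheme.basicOpen_of_isUnit _ (.of_mul_eq_one_right _ h₃)]
      trivial
    rw [Scheme.basicOpen_appLE] at h₄
    exact hx (hτ₂ h₄.2)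
  obtain ⟨l', hl'⟩ := exists_comp_ι_eq_of_closedPoint_mem l hmem
  have hl'' : Spec.map a ≫ l' = i₁' := by
    rw [← cancel_mono U₁.ι, Category.assoc, hl']
    exact hl₁
  refine ⟨⟨l', hl'', ?_⟩⟩
  refine eq_of_SpecMap_comp_eq ha ?_
  rw [← hi, reassoc_of% hl'']


theorem map_algebraMap_sections (X : Over (Spec (.of k))) {U V : X.left.Opens} (h : U ≤ V) (c : k) :
    X.left.presheaf.map (homOfLE h).op (algebraMap k _ c) = algebraMap k Γ(X.left, U) c :=
  congr($(Scheme.Hom.appLE_map X.hom (le_preimage_top _ V) (homOfLE h).op)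
    ((Scheme.ΓSpecIso (.of k)).inv c))

theorem germ_algebraMap_sections (X : Over (Spec (.of k))) {U : X.left.Opens} {x : X.left}
    (hx : x ∈ U) (c : k) : X.left.presheaf.germ U x hx (algebraMap k _ c) =
      X.left.presheaf.germ ⊤ x trivial (algebraMap k _ c) := by
  rw [← map_algebraMap_sections X le_top, X.left.presheaf.germ_res_apply]

variable (X : Over (Spec (.of k))) [IsSmoothProperCurve X]

theorem isNoetherian_left : IsNoetherian X.left := by
  have := LocallyOfFiniteType.isLocallyNoetherian X.hom
  have : CompactSpace X.left := QuasiCompact.compactSpace_of_compactSpace X.hom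
  exact { }

variable [IsAlgClosed k]

/-- The open subscheme on which a nonconstant rational function is regular is affine. -/
theorem isAffineOpen_of_sup_eq_top {U₁ U₂ : X.left.Opens} (hU : U₁ ⊔ U₂ = ⊤)
    (hne : (U₁ : Set X.left).Nonempty) (τ₁ : Γ(X.left, U₁))
    (hc : ∀ c, algebraMap k _ c ≠ τ₁)
    (τ₂ : Γ(X.left, U₂)) (hτ₂ : X.left.basicOpen τ₂ ≤ U₁)
    (hτ : X.left.presheaf.map (homOfLE inf_le_left).op τ₁ *
      X.left.presheaf.map (homOfLE inf_le_right).op τ₂ = (1 : Γ(X.left, U₁ ⊓ U₂))) :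
    IsAffineOpen U₁ := by
  have := isNoetherian_left X
  have : CompactSpace U₁ :=
    isCompact_iff_compactSpace.1 (TopologicalSpace.NoetherianSpace.isCompact _)
  let Z : Over (Spec (.of k)) := Over.mk (U₁.ι ≫ X.hom)
  let τ : Γ(Z.left, ⊤) := U₁.ι.appLE U₁ ⊤ (by simp) τ₁
  let h := toAffineLine Z τ
  have h₁ : UniversallyClosed h := universallyClosed_toAffineLine X hU τ₁ τ₂ hτ₂ hτ
  have hne₁ : Nonempty U₁ := hne.to_subtype
  have hZ : IsIntegral Z.left := inferInstanceAs (IsIntegral U₁)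
  have : LocallyOfFiniteType Z.hom := inferInstanceAs (LocallyOfFiniteType (U₁.ι ≫ X.hom))
  have : IsSeparated Z.hom := inferInstanceAs (IsSeparated (U₁.ι ≫ X.hom))
  have h₂ : LocallyQuasiFinite h := by
    refine locallyQuasiFinite_toAffineLine Z ?_ τ fun c hcτ ↦ hc c ?_
    · intro V hV hV'
      have hV₁ := hV.image_of_isOpenImmersion U₁.ι
      have : Nonempty ((U₁.ι ''ᵁ V : X.left.Opens)) := ⟨⟨_, ⟨_, hV'.some.2, rfl⟩⟩⟩
      have : IsDedekindDomain Γ(X.left, U₁.ι ''ᵁ V) := isDedekindDomain_sections X hV₁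
      exact this
    · let p : Z ⟶ X := Over.homMk U₁.ι rfl
      have hp := congr($(algebraMap_sections_comp_appLE p U₁ ⊤ (by simp [p, Z])) c)
      have hinj : Function.Injective (U₁.ι.appLE U₁ ⊤ (by simp)) := by
        rw [Scheme.Opens.ι_appLE]
        have : Nonempty (U₁.ι ''ᵁ ⊤) := ⟨⟨_, ⟨_, (Set.mem_univ hne₁.some), rfl⟩⟩⟩
        exact map_injective_of_isIntegral X.left _
      exact hinj (hp.trans hcτ)
  have hcomp := toAffineLine_comp Z τ
  have : LocallyOfFiniteType (h ≫
      Spec.map (CommRingCat.ofHom (algebraMap k (Polynomial k)))) := by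
    rwa [hcomp]
  have := locallyOfFiniteType_of_comp h
    (Spec.map (CommRingCat.ofHom (algebraMap k (Polynomial k))))
  have : IsSeparated (h ≫
      Spec.map (CommRingCat.ofHom (algebraMap k (Polynomial k)))) := by
    rwa [hcomp]
  have := IsSeparated.of_comp h
    (Spec.map (CommRingCat.ofHom (algebraMap k (Polynomial k))))
  -- Proper and quasi-finite gives finite, so `U₁` is affine because the affine line is.
  have : IsProper h := { }
  have : IsFinite h := .of_isProper_of_locallyQuasiFinite h
  exact isAffine_of_isAffineHom h

theorem isAffineOpen_regularLocus {a : X.left.functionField}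
    (ha : ∀ c : k, X.left.presheaf.germ ⊤ (genericPoint X.left) trivial (algebraMap k _ c) ≠ a) :
    IsAffineOpen (regularLocus a) := by
  have ha₀ : a ≠ 0 := fun h ↦ ha 0 (by rw [map_zero, map_zero, h])
  obtain ⟨τ₁, h₁⟩ := exists_germ_regularLocus_eq a
  obtain ⟨τ₂, h₂⟩ := exists_germ_regularLocus_eq a⁻¹
  have hb := regularLocus_inf_regularLocus_inv (inv_ne_zero ha₀) h₂
  rw [inv_inv] at hb
  refine isAffineOpen_of_sup_eq_top X (regularLocus_sup_regularLocus_inv a inferInstance)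
    ⟨_, genericPoint_mem_regularLocus a⟩ τ₁ (fun c hc ↦ ha c ?_) τ₂ (hb.ge.trans inf_le_right) ?_
  · rw [← germ_algebraMap_sections X (genericPoint_mem_regularLocus a), hc, h₁]
  · have hm : genericPoint X.left ∈ regularLocus a ⊓ regularLocus a⁻¹ :=
      ⟨genericPoint_mem_regularLocus a, genericPoint_mem_regularLocus a⁻¹⟩
    refine germ_injective_of_isIntegral X.left _ hm ?_
    rw [map_mul, map_one, X.left.presheaf.germ_res_apply, X.left.presheaf.germ_res_apply, h₁, h₂,
      mul_inv_cancel₀ ha₀]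

end CurveCovers

/-! ### Stable affine covers by two charts -/

namespace CurveCovers

variable {k : Type u} [Field k]

section

variable (X : Over (Spec (.of k))) [IsSmoothProperCurve X] (H : Subgroup (Aut X)) [Finite H]

/-- The finitely many translates of an affine open have affine intersection because `X` is
separated, and automorphisms fix the generic point. -/
theorem exists_isAffineOpen_isStable :
    ∃ U : X.left.Opens, IsAffineOpen U ∧ IsStable H U ∧ genericPoint X.left ∈ U := by
  obtain ⟨V, hV, hη, -⟩ := exists_isAffineOpen_isStandardSmooth X (genericPoint X.left)
  have : X.left.IsSeparated := ⟨by rw [← Limits.terminal.comp_from X.hom]; infer_instance⟩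
  have hmem (x : X.left) : x ∈ ⨅ σ : H, σ.1.hom.left ⁻¹ᵁ V ↔ ∀ σ : H, σ.1.hom.left x ∈ V := by
    rw [← SetLike.mem_coe, TopologicalSpace.Opens.coe_iInf]
    exact Set.mem_iInter
  refine ⟨⨅ σ : H, σ.1.hom.left ⁻¹ᵁ V, .iInf fun σ ↦ hV.preimage σ.1.hom.left,
    fun σ hσ x hx ↦ ?_, (hmem _).2 fun σ ↦ genericPoint_mem_preimage σ.1 hη⟩
  exact (hmem _).2 fun τ ↦ (hmem x).1 hx (τ * (⟨σ, hσ⟩ : H))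

/-- If all invariants were constants, the ring of sections would be integral over `k`, hence equal
to `k`. -/
theorem exists_invariant_ne_algebraMap [IsAlgClosed k] {U : X.left.Opens} (hU : IsAffineOpen U)
    (hS : IsStable H U) (hne : (U : Set X.left).Nonempty) :
    ∃ t : Γ(X.left, U), (∀ (σ) (hσ : σ ∈ H), sectionsMap σ.hom U U (hS σ hσ) t = t) ∧
      ∀ c : k, algebraMap k _ c ≠ t := by
  by_contra! h
  let := sectionsAction hS
  have := sectionsAction_smulCommClass hS
  have : Algebra.IsInvariant k Γ(X.left, U) H :=
    ⟨fun b hb ↦ h b ((sectionsAction_forall_smul_eq_iff hS b).1 hb)⟩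
  have := Algebra.IsInvariant.isIntegral k Γ(X.left, U) H
  have : Nonempty U := hne.to_subtype
  exact not_surjective_algebraMap_sections X hU hne fun b ↦
    (Algebra.IsIntegral.isIntegral b).exists_algebraMap_eq_of_isAlgClosed

end

variable {X : Over (Spec (.of k))} {H : Subgroup (Aut X)}

theorem isStable_basicOpen {U : X.left.Opens} (hS : IsStable H U) {t : Γ(X.left, U)}
    (ht : ∀ (σ) (hσ : σ ∈ H), sectionsMap σ.hom U U (hS σ hσ) t = t) :
    IsStable H (X.left.basicOpen t) := by
  intro σ hσ x hx
  rw [← ht σ hσ] at hx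
  have : x ∈ X.left.basicOpen (σ.hom.left.appLE U U (hS σ hσ) t) := hx
  rw [Scheme.basicOpen_appLE] at this
  exact this.2

theorem IsStable.inf {U V : X.left.Opens} (hU : IsStable H U) (hV : IsStable H V) :
    IsStable H (U ⊓ V) := fun σ hσ _ hx ↦ ⟨hU σ hσ hx.1, hV σ hσ hx.2⟩

theorem exists_invariant_inv [IsIntegral X.left] {U : X.left.Opens} (hS : IsStable H U)
    {t : Γ(X.left, U)}
    (hη : genericPoint X.left ∈ U)
    (ht : ∀ (σ) (hσ : σ ∈ H), sectionsMap σ.hom U U (hS σ hσ) t = t) (ht₀ : t ≠ 0) :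
    ∃ (V : X.left.Opens) (hV : IsStable H V) (hηV : genericPoint X.left ∈ V) (s : Γ(X.left, V)),
      (∀ (σ) (hσ : σ ∈ H), sectionsMap σ.hom V V (hV σ hσ) s = s) ∧
      X.left.presheaf.germ _ _ hηV s = (X.left.presheaf.germ _ _ hη t)⁻¹ := by
  have hV := isStable_basicOpen hS ht
  obtain ⟨v, hv⟩ : ∃ v, X.left.presheaf.map (homOfLE (X.left.basicOpen_le t)).op t * v =
      (1 : Γ(X.left, X.left.basicOpen t)) :=
    (RingedSpace.isUnit_res_basicOpen X.left.toRingedSpace t).exists_right_inv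
  have hηV : genericPoint X.left ∈ X.left.basicOpen t := by
    rw [Scheme.mem_basicOpen _ _ _ hη]
    refine IsUnit.mk0 _ fun h ↦ ht₀ ?_
    exact germ_injective_of_isIntegral X.left _ hη (h.trans (map_zero _).symm)
  refine ⟨_, hV, hηV, v, fun σ hσ ↦ ?_, ?_⟩
  · have h := congr(sectionsMap σ.hom _ _ (hV σ hσ) $hv)
    rw [map_mul, map_one, sectionsMap_map,
      ← map_sectionsMap σ.hom (hS σ hσ) (X.left.basicOpen_le t), ht σ hσ] at h
    calc _ = _ * (X.left.presheaf.map (homOfLE (X.left.basicOpen_le t)).op t * v) := by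
          rw [hv, mul_one]
      _ = v := by rw [mul_left_comm, ← mul_assoc, h, one_mul]
  · refine eq_inv_of_mul_eq_one_right ?_
    have h := congr(X.left.presheaf.germ _ _ hηV $hv)
    rwa [map_mul, map_one, X.left.presheaf.germ_res_apply] at h

/-- A curve is covered by two affine open subschemes that are stable under a given finite group
of automorphisms, and whose intersection is a basic open subscheme of both, defined by
nonconstant invariant sections. -/
theorem exists_isStable_cover [IsAlgClosed k] (X : Over (Spec (.of k))) [IsSmoothProperCurve X]
    (H : Subgroup (Aut X)) [Finite H] :
    ∃ (U₁ U₂ : X.left.Opens) (h₁ : IsStable H U₁) (h₂ : IsStable H U₂)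
      (τ₁ : Γ(X.left, U₁)) (τ₂ : Γ(X.left, U₂)), IsAffineOpen U₁ ∧ IsAffineOpen U₂ ∧
      genericPoint X.left ∈ U₁ ⊓ U₂ ∧ U₁ ⊔ U₂ = ⊤ ∧
      (∀ (σ) (hσ : σ ∈ H), sectionsMap σ.hom U₁ U₁ (h₁ σ hσ) τ₁ = τ₁) ∧
      (∀ (σ) (hσ : σ ∈ H), sectionsMap σ.hom U₂ U₂ (h₂ σ hσ) τ₂ = τ₂) ∧
      (∀ c : k, algebraMap k _ c ≠ τ₁) ∧ (∀ c : k, algebraMap k _ c ≠ τ₂) ∧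
      U₁ ⊓ U₂ = X.left.basicOpen τ₁ ∧ U₁ ⊓ U₂ = X.left.basicOpen τ₂ := by
  obtain ⟨U, hU, hS, hη⟩ := exists_isAffineOpen_isStable X H
  obtain ⟨t, ht, hc⟩ := exists_invariant_ne_algebraMap X H hU hS ⟨_, hη⟩
  have ht₀ : t ≠ 0 := fun h ↦ hc 0 (by rw [map_zero, h])
  obtain ⟨V, hV, hηV, s, hs, hst⟩ := exists_invariant_inv hS hη ht ht₀
  set a := X.left.presheaf.germ _ _ hη t with ha
  have ha₀ : a ≠ 0 := fun h ↦ ht₀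
    (germ_injective_of_isIntegral X.left _ hη (h.trans (map_zero _).symm))
  have hca (c : k) : X.left.presheaf.germ ⊤ (genericPoint X.left) trivial (algebraMap k _ c) ≠ a := by
    rw [← germ_algebraMap_sections X hη]
    exact fun h ↦ hc c (germ_injective_of_isIntegral X.left _ hη h)
  have hca' (c : k) :
      X.left.presheaf.germ ⊤ (genericPoint X.left) trivial (algebraMap k _ c) ≠ a⁻¹ := by
    intro h
    refine hca c⁻¹ ?_
    rw [← inv_inj, ← h]
    let φ : k →+* X.left.functionField := (X.left.presheaf.germ ⊤ (genericPoint X.left) trivial).hom.comp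
      (algebraMap k Γ(X.left, ⊤))
    exact (congrArg _ (map_inv₀ φ c)).trans (inv_inv (φ c))
  obtain ⟨τ₁, hτ₁⟩ := exists_germ_regularLocus_eq a
  obtain ⟨τ₂, hτ₂⟩ := exists_germ_regularLocus_eq a⁻¹
  -- The inverse `a⁻¹` is itself the germ of an invariant section, on the set where `t` is
  -- invertible.
  have h₂ : IsStable H (regularLocus a⁻¹) := hst ▸ isStable_regularLocus hV hηV hs
  refine ⟨regularLocus a, regularLocus a⁻¹, isStable_regularLocus hS hη ht, h₂, τ₁, τ₂,
    isAffineOpen_regularLocus X hca, isAffineOpen_regularLocus X hca',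
    ⟨genericPoint_mem_regularLocus _, genericPoint_mem_regularLocus _⟩,
    regularLocus_sup_regularLocus_inv a inferInstance,
    sectionsMap_eq_of_germ_eq hS hη ht hτ₁, ?_, fun c hc ↦ hca c ?_, fun c hc ↦ hca' c ?_,
    regularLocus_inf_regularLocus_inv ha₀ hτ₁, ?_⟩
  · have key (b : X.left.functionField) (hb : X.left.presheaf.germ _ _ hηV s = b)
        (hS : IsStable H (regularLocus b)) (τ : Γ(X.left, regularLocus b))
        (hτ : X.left.presheaf.germ _ _ (genericPoint_mem_regularLocus b) τ = b) (σ) (hσ : σ ∈ H) :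
        sectionsMap σ.hom _ _ (hS σ hσ) τ = τ := by
      subst hb
      exact sectionsMap_eq_of_germ_eq hV hηV hs hτ σ hσ
    exact key _ hst h₂ τ₂ hτ₂
  · rw [← germ_algebraMap_sections X (genericPoint_mem_regularLocus a), hc, hτ₁]
  · rw [← germ_algebraMap_sections X (genericPoint_mem_regularLocus a⁻¹), hc, hτ₂]
  · rw [inf_comm, ← regularLocus_inf_regularLocus_inv (inv_ne_zero ha₀) hτ₂, inv_inv]

end CurveCovers

namespace CurveCovers

variable {k : Type u} [Field k] {X : Over (Spec (.of k))} {H : Subgroup (Aut X)}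

/-! ### Quotients of affine open subschemes -/

/-- The invariant sections over a stable open subscheme. -/
noncomputable def invariants {U : X.left.Opens} (hU : IsStable H U) : Subalgebra k Γ(X.left, U) where
  carrier := {b | ∀ (σ) (hσ : σ ∈ H), sectionsMap σ.hom U U (hU σ hσ) b = b}
  mul_mem' ha hb σ hσ := by rw [map_mul, ha σ hσ, hb σ hσ]
  add_mem' ha hb σ hσ := by rw [map_add, ha σ hσ, hb σ hσ]
  algebraMap_mem' c σ hσ := AlgHom.commutes _ c

/-- Restriction of invariant sections. -/
noncomputable def invariantsRes {U V : X.left.Opens} (hU : IsStable H U) (hV : IsStable H V)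
    (h : V ≤ U) : invariants hU →+* invariants hV where
  toFun b := ⟨X.left.presheaf.map (homOfLE h).op b.1, fun σ hσ ↦ by
    rw [sectionsMap_map, ← map_sectionsMap σ.hom (hU σ hσ) h, b.2 σ hσ]⟩
  map_one' := Subtype.ext (map_one _)
  map_mul' _ _ := Subtype.ext (map_mul _ _ _)
  map_zero' := Subtype.ext (map_zero _)
  map_add' _ _ := Subtype.ext (map_add _ _ _)

/-- Invariants commute with inverting an invariant: the inverse of `τ` is invariant, and so is the
numerator `a` of an invariant fraction, since restriction is injective and `a` restricts to the
invariant section `b τ ^ n`. -/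
theorem isLocalization_invariantsRes [IsIntegral X.left] {U V : X.left.Opens} (hU : IsStable H U)
    (hV : IsStable H V) (hU' : IsAffineOpen U) (hη : genericPoint X.left ∈ V) (h : V ≤ U)
    (τ : invariants hU) (hτ : V = X.left.basicOpen τ.1) :
    letI := (invariantsRes hU hV h).toAlgebra
    IsLocalization.Away τ (invariants hV) := by
  let := (invariantsRes hU hV h).toAlgebra
  let : Algebra Γ(X.left, U) Γ(X.left, V) := (X.left.presheaf.map (homOfLE h).op).hom.toAlgebra
  have hloc : IsLocalization.Away τ.1 Γ(X.left, V) := by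
    subst hτ
    exact hU'.isLocalization_basicOpen τ.1
  have hinj : Function.Injective (X.left.presheaf.map (homOfLE h).op) := by
    have : Nonempty V := ⟨⟨_, hη⟩⟩
    exact map_injective_of_isIntegral X.left _
  have hinj' : Function.Injective (invariantsRes hU hV h) := fun a b hab ↦
    Subtype.ext (hinj congr(($hab).1))
  obtain ⟨v, hv⟩ := (IsLocalization.Away.algebraMap_isUnit (S := Γ(X.left, V)) τ.1).exists_right_inv
  have hv' : v ∈ invariants hV := fun σ hσ ↦ by
    have h₁ := (invariantsRes hU hV h τ).2 σ hσ
    have h₂ := congr(sectionsMap σ.hom V V (hV σ hσ) $hv)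
    rw [map_mul, map_one] at h₂
    have h₃ : sectionsMap σ.hom V V (hV σ hσ) (algebraMap Γ(X.left, U) Γ(X.left, V) τ.1) =
      algebraMap Γ(X.left, U) Γ(X.left, V) τ.1 := h₁
    rw [h₃] at h₂
    exact (IsUnit.of_mul_eq_one _ hv).mul_left_cancel (h₂.trans hv.symm)
  refine ⟨?_, fun b ↦ ?_, fun {a b} hab ↦ ⟨1, by rw [hinj' hab]⟩⟩
  · rintro ⟨_, n, rfl⟩
    rw [map_pow]
    exact (IsUnit.of_mul_eq_one ⟨v, hv'⟩ (Subtype.ext hv)).pow n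
  · obtain ⟨n, a, ha⟩ := IsLocalization.Away.surj τ.1 b.1
    refine ⟨⟨⟨a, fun σ hσ ↦ hinj ?_⟩, ⟨_, n, rfl⟩⟩, Subtype.ext ?_⟩
    · rw [map_sectionsMap, ← sectionsMap_map σ.hom (hV σ hσ) h]
      have ha' : X.left.presheaf.map (homOfLE h).op a ∈ invariants hV := by
        refine Eq.subst (motive := (· ∈ invariants hV)) ha ?_
        exact (b * invariantsRes hU hV h τ ^ n).2
      exact ha' σ hσ
    · rw [map_pow]
      exact ha

/-- The quotient of a stable open subscheme. -/
noncomputable def toQuotient {U : X.left.Opens} (hU : IsStable H U) :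
    U.toScheme ⟶ Spec (.of (invariants hU)) :=
  U.toSpecΓ ≫ Spec.map (CommRingCat.ofHom (invariants hU).val.toRingHom)

theorem homOfLE_toQuotient {U V : X.left.Opens} (hU : IsStable H U) (hV : IsStable H V)
    (h : V ≤ U) : X.left.homOfLE h ≫ toQuotient hU =
      toQuotient hV ≫ Spec.map (CommRingCat.ofHom (invariantsRes hU hV h)) := by
  rw [toQuotient, toQuotient, ← Scheme.Opens.toSpecΓ_SpecMap_presheaf_map_assoc, Category.assoc,
    ← Spec.map_comp, ← Spec.map_comp]
  rfl

theorem toQuotient_comp {U : X.left.Opens} (hU : IsStable H U) :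
    toQuotient hU ≫ Spec.map (CommRingCat.ofHom (algebraMap k (invariants hU))) =
      U.ι ≫ X.hom := by
  rw [← toSpecΓ_SpecMap_algebraMap X, ← Scheme.Opens.toSpecΓ_SpecMap_presheaf_map_top_assoc,
    toQuotient, Category.assoc, ← Spec.map_comp, ← Spec.map_comp]
  congr 2
  ext c
  exact (map_algebraMap_sections X le_top c).symm

theorem resLE_toQuotient {U : X.left.Opens} (hU : IsStable H U) (σ) (hσ : σ ∈ H) :
    σ.hom.left.resLE U U (hU σ hσ) ≫ toQuotient hU = toQuotient hU := by
  rw [toQuotient, ← Scheme.Opens.toSpecΓ_SpecMap_appLE_assoc, ← Spec.map_comp]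
  congr 2
  ext b
  exact b.2 σ hσ

theorem toQuotient_mem_basicOpen {U : X.left.Opens} (hU : IsStable H U) (τ : invariants hU) (u : U) :
    toQuotient hU u ∈ PrimeSpectrum.basicOpen τ ↔ u.1 ∈ X.left.basicOpen τ.1 := by
  have := congr(u ∈ $(Scheme.Opens.toSpecΓ_preimage_basicOpen U τ.1))
  exact this.to_iff

/-- A curve admits a quotient by a finite group of automorphisms. -/
theorem exists_quotient [IsAlgClosed k] (X : Over (Spec (.of k))) [IsSmoothProperCurve X]
    (H : Subgroup (Aut X)) [Finite H] :
    ∃ (U₁ U₂ : X.left.Opens) (h₁ : IsStable H U₁) (h₂ : IsStable H U₂) (Y : Over (Spec (.of k))) (f : X ⟶ Y)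
      (j₁ : Spec (.of (invariants h₁)) ⟶ Y.left) (j₂ : Spec (.of (invariants h₂)) ⟶ Y.left)
      (_ : IsOpenImmersion j₁) (_ : IsOpenImmersion j₂),
      IsAffineOpen U₁ ∧ IsAffineOpen U₂ ∧ genericPoint X.left ∈ U₁ ⊓ U₂ ∧ U₁ ⊔ U₂ = ⊤ ∧
      (∃ τ ∈ invariants h₁, ∀ c : k, algebraMap k _ c ≠ τ) ∧
      (∃ τ ∈ invariants h₂, ∀ c : k, algebraMap k _ c ≠ τ) ∧
      j₁.opensRange ⊔ j₂.opensRange = ⊤ ∧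
      IsPullback (toQuotient h₁) U₁.ι j₁ f.left ∧ IsPullback (toQuotient h₂) U₂.ι j₂ f.left ∧
      j₁ ≫ Y.hom = Spec.map (CommRingCat.ofHom (algebraMap k (invariants h₁))) ∧
      j₂ ≫ Y.hom = Spec.map (CommRingCat.ofHom (algebraMap k (invariants h₂))) := by
  obtain ⟨U₁, U₂, h₁, h₂, τ₁, τ₂, hU₁, hU₂, hη, hU, ht₁, ht₂, hc₁, hc₂, hb₁, hb₂⟩ :=
    exists_isStable_cover X H
  have h₁₂ := h₁.inf h₂
  let i₁ : Spec (.of (invariants h₁₂)) ⟶ Spec (.of (invariants h₁)) :=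
    Spec.map (CommRingCat.ofHom (invariantsRes h₁ h₁₂ inf_le_left))
  let i₂ : Spec (.of (invariants h₁₂)) ⟶ Spec (.of (invariants h₂)) :=
    Spec.map (CommRingCat.ofHom (invariantsRes h₂ h₁₂ inf_le_right))
  have hi₁ : ∃ _ : IsOpenImmersion i₁, i₁.opensRange = PrimeSpectrum.basicOpen (⟨τ₁, ht₁⟩ : invariants h₁) := by
    let := (invariantsRes h₁ h₁₂ inf_le_left).toAlgebra
    have := isLocalization_invariantsRes h₁ h₁₂ hU₁ hη inf_le_left ⟨τ₁, ht₁⟩ hb₁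
    have hi : IsOpenImmersion i₁ := IsOpenImmersion.of_isLocalization (⟨τ₁, ht₁⟩ : invariants h₁)
    exact ⟨hi, TopologicalSpace.Opens.ext (PrimeSpectrum.localization_away_comap_range _ _)⟩
  have hi₂ : ∃ _ : IsOpenImmersion i₂, i₂.opensRange = PrimeSpectrum.basicOpen (⟨τ₂, ht₂⟩ : invariants h₂) := by
    let := (invariantsRes h₂ h₁₂ inf_le_right).toAlgebra
    have := isLocalization_invariantsRes h₂ h₁₂ hU₂ hη inf_le_right ⟨τ₂, ht₂⟩ hb₂
    have hi : IsOpenImmersion i₂ := IsOpenImmersion.of_isLocalization (⟨τ₂, ht₂⟩ : invariants h₂)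
    exact ⟨hi, TopologicalSpace.Opens.ext (PrimeSpectrum.localization_away_comap_range _ _)⟩
  obtain ⟨hi₁, hr₁⟩ := hi₁
  obtain ⟨hi₂, hr₂⟩ := hi₂
  have key {U V : X.left.Opens} (hU : IsStable H U) (hV : IsStable H V) (h : V ≤ U) :
      Spec.map (CommRingCat.ofHom (invariantsRes hU hV h)) ≫
      Spec.map (CommRingCat.ofHom (algebraMap k (invariants hU))) =
      Spec.map (CommRingCat.ofHom (algebraMap k (invariants hV))) := by
    rw [← Spec.map_comp]
    congr 1
    ext c
    exact map_algebraMap_sections X h c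
  -- The overlap of the quotient charts pulls back exactly to `U₁ ⊓ U₂`; this makes the charts of
  -- `Y` pull back to the charts of `X`.
  have hr₁' (u : U₁) (hu : toQuotient h₁ u ∈ i₁.opensRange) : u.1 ∈ U₂ := by
    rw [hr₁] at hu
    have := (toQuotient_mem_basicOpen h₁ _ u).1 hu
    exact (hb₁.ge this).2
  have hr₂' (u : U₂) (hu : toQuotient h₂ u ∈ i₂.opensRange) : u.1 ∈ U₁ := by
    rw [hr₂] at hu
    have := (toQuotient_mem_basicOpen h₂ _ u).1 hu
    exact (hb₂.ge this).1
  obtain ⟨Y, f, j₁, j₂, y, hj₁, hj₂, hj, hp₁, hp₂, hy₁, hy₂, hf⟩ := exists_gluing_hom X.hom hU i₁ i₂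
    (Spec.map (CommRingCat.ofHom (algebraMap k (invariants h₁))))
    (Spec.map (CommRingCat.ofHom (algebraMap k (invariants h₂))))
    ((key _ _ _).trans (key _ _ _).symm) (toQuotient h₁) (toQuotient h₂) (toQuotient h₁₂)
    (homOfLE_toQuotient _ _ _) (homOfLE_toQuotient _ _ _)
    hr₁' hr₂' (toQuotient_comp h₁) (toQuotient_comp h₂)
  exact ⟨U₁, U₂, h₁, h₂, Over.mk y, Over.homMk f hf, j₁, j₂, hj₁, hj₂, hU₁, hU₂, hη, hU,
    ⟨τ₁, ht₁, hc₁⟩, ⟨τ₂, ht₂, hc₂⟩, hj, hp₁, hp₂, hy₁, hy₂⟩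

end CurveCovers

/-! ### Descent of properties along quotient morphisms -/

section

open Limits

/-- If the source of a proper surjective morphism is separated, then so is the target. -/
theorem AlgebraicGeometry.IsSeparated.of_comp_of_surjective {X Y S : Scheme.{u}} (f : X ⟶ Y)
    (y : Y ⟶ S) [IsProper f] [Surjective f] [IsSeparated (f ≫ y)] : IsSeparated y := by
  let p : pullback (f ≫ y) (f ≫ y) ⟶ pullback y y :=
    pullback.map (f ≫ y) (f ≫ y) y y f f (𝟙 S) (by simp) (by simp)
  have : IsProper p := MorphismProperty.pullbackMap (P := @IsProper) ‹_› ‹_› rfl rfl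
  have hp : f ≫ pullback.diagonal y = pullback.diagonal (f ≫ y) ≫ p := by
    have h₁ : p ≫ pullback.fst y y = pullback.fst _ _ ≫ f := pullback.lift_fst _ _ _
    have h₂ : p ≫ pullback.snd y y = pullback.snd _ _ ≫ f := pullback.lift_snd _ _ _
    refine pullback.hom_ext ?_ ?_
    · rw [Category.assoc, Category.assoc, h₁, pullback.diagonal_fst, pullback.diagonal_fst_assoc,
        Category.comp_id]
    · rw [Category.assoc, Category.assoc, h₂, pullback.diagonal_snd, pullback.diagonal_snd_assoc,
        Category.comp_id]
  -- The diagonal is an immersion, so only its range has to be closed; as `f` is surjective, that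
  -- range is the image under the closed map `p` of the closed diagonal of `X`.
  refine ⟨.of_isPreimmersion _ ?_⟩
  have h : Set.range (pullback.diagonal y) = p '' Set.range (pullback.diagonal (f ≫ y)) := by
    rw [← Set.range_comp, ← f.surjective.range_comp]
    exact congr(Set.range $hp)
  rw [h]
  exact p.isClosedMap _ (pullback.diagonal (f ≫ y)).isClosedEmbedding.isClosed_range

/-- If the source of a proper surjective morphism is proper, then so is the target. -/
theorem AlgebraicGeometry.IsProper.of_comp_of_surjective {X Y S : Scheme.{u}} (f : X ⟶ Y)
    (y : Y ⟶ S) [IsProper f] [Surjective f] [IsProper (f ≫ y)] [LocallyOfFiniteType y] :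
    IsProper y :=
  have := IsSeparated.of_comp_of_surjective f y
  have := UniversallyClosed.of_comp_surjective f y
  { }

theorem AlgebraicGeometry.irreducibleSpace_of_surjective {X Y : Scheme.{u}} (f : X ⟶ Y)
    [Surjective f] [IrreducibleSpace X] : IrreducibleSpace Y := by
  have : PreirreducibleSpace Y := by
    constructor
    have := (PreirreducibleSpace.isPreirreducible_univ (X := X)).image f f.continuous.continuousOn
    rwa [Set.image_univ, f.surjective.range_eq] at this
  have : Nonempty Y := Nonempty.map f inferInstance
  exact ⟨‹_›⟩

/-- The cover of a scheme by two open subschemes. -/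
noncomputable def AlgebraicGeometry.Scheme.openCoverOfPair {Y V₁ V₂ : Scheme.{u}} (j₁ : V₁ ⟶ Y)
    (j₂ : V₂ ⟶ Y) [IsOpenImmersion j₁] [IsOpenImmersion j₂]
    (h : j₁.opensRange ⊔ j₂.opensRange = ⊤) : Y.OpenCover :=
  .mkOfCovers Bool (fun b ↦ b.rec V₂ V₁) (fun b ↦ b.rec j₂ j₁)
    (fun x ↦ by
      obtain ⟨y, hy⟩ | ⟨y, hy⟩ := (h.ge (Set.mem_univ x) : x ∈ j₁.opensRange ⊔ j₂.opensRange)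
      · exact ⟨true, y, hy⟩
      · exact ⟨false, y, hy⟩)
    (fun b ↦ by cases b <;> assumption)

section

variable {Y V₁ V₂ : Scheme.{u}} (j₁ : V₁ ⟶ Y) (j₂ : V₂ ⟶ Y) [IsOpenImmersion j₁]
  [IsOpenImmersion j₂]

theorem AlgebraicGeometry.of_pair_source (hj : j₁.opensRange ⊔ j₂.opensRange = ⊤)
    {P : MorphismProperty Scheme.{u}}
    [IsZariskiLocalAtSource P] {S : Scheme.{u}} {y : Y ⟶ S} (h₁ : P (j₁ ≫ y)) (h₂ : P (j₂ ≫ y)) :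
    P y :=
  (IsZariskiLocalAtSource.iff_of_openCover (Scheme.openCoverOfPair j₁ j₂ hj)).2
    fun b ↦ match b with
    | true => h₁
    | false => h₂

theorem AlgebraicGeometry.of_pair_target (hj : j₁.opensRange ⊔ j₂.opensRange = ⊤)
    {P : MorphismProperty Scheme.{u}}
    [IsZariskiLocalAtTarget P] {X U₁ U₂ : Scheme.{u}} {f : X ⟶ Y} {g₁ : U₁ ⟶ V₁} {i₁ : U₁ ⟶ X}
    {g₂ : U₂ ⟶ V₂} {i₂ : U₂ ⟶ X} (hp₁ : IsPullback g₁ i₁ j₁ f) (hp₂ : IsPullback g₂ i₂ j₂ f)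
    (h₁ : P g₁) (h₂ : P g₂) : P f :=
  (IsZariskiLocalAtTarget.iff_of_openCover (Scheme.openCoverOfPair j₁ j₂ hj)).2
    fun b ↦ match b with
    | true => by
      have := hp₁.flip.isoPullback_inv_snd
      change P (pullback.snd f j₁)
      rw [← this]
      exact (P.cancel_left_of_respectsIso _ _).2 h₁
    | false => by
      have := hp₂.flip.isoPullback_inv_snd
      change P (pullback.snd f j₂)
      rw [← this]
      exact (P.cancel_left_of_respectsIso _ _).2 h₂

theorem AlgebraicGeometry.isReduced_of_pair (hj : j₁.opensRange ⊔ j₂.opensRange = ⊤)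
    [IsReduced V₁] [IsReduced V₂] : IsReduced Y :=
  have h (b : Bool) : IsReduced ((Scheme.openCoverOfPair j₁ j₂ hj).X b) := match b with
    | true => ‹IsReduced V₁›
    | false => ‹IsReduced V₂›
  have (b : (Scheme.openCoverOfPair j₁ j₂ hj).I₀) := h b
  .of_openCover Y (Scheme.openCoverOfPair j₁ j₂ hj)

end

/-- A Dedekind domain of finite type over an algebraically closed field defines a smooth affine
curve. -/
theorem AlgebraicGeometry.smoothOfRelativeDimension_one_SpecMap (k A : Type u) [Field k]
    [IsAlgClosed k] [CommRing A] [Algebra k A] [Algebra.FiniteType k A] [IsDedekindDomain A]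
    (hA : ¬ Function.Surjective (algebraMap k A)) :
    SmoothOfRelativeDimension 1 (Spec.map (CommRingCat.ofHom (algebraMap k A))) := by
  rw [HasRingHomProperty.Spec_iff (P := @SmoothOfRelativeDimension 1)]
  refine ⟨{f | Algebra.IsStandardSmoothOfRelativeDimension 1 k (Localization.Away f)}, ?_,
    fun f hf ↦ ?_⟩
  · by_contra h
    obtain ⟨P, hP, hle⟩ := Ideal.exists_le_maximal _ h
    obtain ⟨f, hf, hf'⟩ := IsDedekindDomain.exists_isStandardSmoothOfRelativeDimension_one k A hA P
    exact hf (hle (Ideal.subset_span hf'))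
  · have : (algebraMap A (Localization.Away f)).comp (algebraMap k A) =
        algebraMap k (Localization.Away f) := (IsScalarTower.algebraMap_eq _ _ _).symm
    change RingHom.IsStandardSmoothOfRelativeDimension 1 ((algebraMap A (Localization.Away f)).comp (algebraMap k A))
    rw [this]
    exact (RingHom.isStandardSmoothOfRelativeDimension_algebraMap 1).2 hf

end

/-- A Galois extension of domains is generically étale. -/
theorem IsGaloisGroup.exists_etale_localizationAway (A B H : Type*) [CommRing A] [CommRing B]
    [IsDomain A] [IsDomain B] [Algebra A B] [FaithfulSMul A B] [Algebra.FinitePresentation A B]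
    [Group H] [Finite H] [MulSemiringAction H B] [IsGaloisGroup H A B] :
    ∃ b : B, b ≠ 0 ∧ ∀ (S : Type u) [CommRing S] [Algebra B S] [IsLocalization.Away b S],
      ((algebraMap B S).comp (algebraMap A B)).Etale := by
  let K := FractionRing A
  let L := FractionRing B
  let : Algebra K L := FractionRing.liftAlgebra A L
  let := IsFractionRing.mulSemiringAction H B L
  have : IsGaloisGroup H K L := IsGaloisGroup.to_isFractionRing H A B K L
  have : IsGalois K L := IsGaloisGroup.isGalois H K L
  have : FiniteDimensional K L := IsGaloisGroup.finiteDimensional H K L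
  -- The extension of fraction fields is separable, so `B` is étale over `A` at its zero ideal, and
  -- étaleness spreads to a basic open set.
  have : Algebra.FormallyEtale K L := Algebra.FormallyEtale.of_isSeparable K L
  have : Algebra.FormallyEtale A K := .of_isLocalization (nonZeroDivisors A)
  have : Algebra.FormallyEtale A L := .comp A K L
  have : IsLocalization.AtPrime L (⊥ : Ideal B) := by
    rw [IsLocalization.AtPrime, Ideal.primeCompl_bot]
    infer_instance
  let e : L ≃ₐ[B] Localization.AtPrime (⊥ : Ideal B) :=
    IsLocalization.algEquiv (⊥ : Ideal B).primeCompl _ _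
  have : Algebra.IsEtaleAt A (⊥ : Ideal B) :=
    Algebra.FormallyEtale.of_equiv (e.restrictScalars A)
  obtain ⟨b, hb, h⟩ := Algebra.exists_etale_of_isEtaleAt (R := A) (⊥ : Ideal B)
  refine ⟨b, hb, fun S _ _ _ ↦ ?_⟩
  let : Algebra A S := ((algebraMap B S).comp (algebraMap A B)).toAlgebra
  have : IsScalarTower A B S := .of_algebraMap_eq' rfl
  let e : Localization.Away b ≃ₐ[B] S := IsLocalization.algEquiv (.powers b) _ _
  exact Algebra.Etale.of_equiv (e.restrictScalars A)

/-! ### Properties of the affine quotients -/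

namespace CurveCovers

variable {k : Type u} [Field k] {X : Over (Spec (.of k))} {H : Subgroup (Aut X)}
  {U : X.left.Opens} (hU : IsStable H U)

theorem isGaloisGroup_invariants [IsIntegral X.left] [IsSeparated X.hom] (hU' : IsAffineOpen U)
    (hne : (U : Set X.left).Nonempty) :
    letI := sectionsAction hU
    IsGaloisGroup H (invariants hU) Γ(X.left, U) := by
  let := sectionsAction hU
  refine ⟨sectionsAction_faithfulSMul hU hU' hne, ⟨fun σ a b ↦ ?_⟩, ⟨fun b hb ↦
    ⟨⟨b, (sectionsAction_forall_smul_eq_iff hU b).1 hb⟩, rfl⟩⟩⟩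
  rw [Algebra.smul_def, Algebra.smul_def, smul_mul']
  congr 1
  exact (sectionsAction_forall_smul_eq_iff hU a.1).2 a.2 σ

section

variable [Finite H] [IsSmoothProperCurve X]

theorem module_finite_invariants (hU' : IsAffineOpen U) (hne : (U : Set X.left).Nonempty) :
    Module.Finite (invariants hU) Γ(X.left, U) := by
  let := sectionsAction hU
  have := isGaloisGroup_invariants hU hU' hne
  have := finiteType_sections X hU'
  exact IsGaloisGroup.module_finite k (invariants hU) Γ(X.left, U) H

theorem finiteType_invariants (hU' : IsAffineOpen U) (hne : (U : Set X.left).Nonempty) :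
    Algebra.FiniteType k (invariants hU) := by
  let := sectionsAction hU
  have := isGaloisGroup_invariants hU hU' hne
  have := finiteType_sections X hU'
  exact IsGaloisGroup.finiteType_of_finiteType k (invariants hU) Γ(X.left, U) H

theorem isDedekindDomain_invariants (hU' : IsAffineOpen U) (hne : (U : Set X.left).Nonempty) :
    IsDedekindDomain (invariants hU) := by
  let := sectionsAction hU
  have := isGaloisGroup_invariants hU hU' hne
  have := finiteType_sections X hU'
  have : Nonempty U := hne.to_subtype
  have := isDedekindDomain_sections X hU'
  exact IsGaloisGroup.isDedekindDomain k (invariants hU) Γ(X.left, U) H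

theorem isFinite_toQuotient (hU' : IsAffineOpen U) (hne : (U : Set X.left).Nonempty) :
    IsFinite (toQuotient hU) := by
  have := module_finite_invariants hU hU' hne
  have : IsFinite (Spec.map (CommRingCat.ofHom (invariants hU).val.toRingHom)) := by
    rw [IsFinite.SpecMap_iff]
    exact this
  rw [toQuotient, ← hU'.isoSpec_hom]
  infer_instance

theorem surjective_toQuotient (hU' : IsAffineOpen U) (hne : (U : Set X.left).Nonempty) :
    Surjective (toQuotient hU) := by
  have := module_finite_invariants hU hU' hne
  have : Surjective (Spec.map (CommRingCat.ofHom (invariants hU).val.toRingHom)) :=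
    ⟨Algebra.IsIntegral.comap_surjective (invariants hU) Γ(X.left, U)⟩
  rw [toQuotient, ← hU'.isoSpec_hom]
  infer_instance

theorem exists_etale_toQuotient (hU' : IsAffineOpen U) (hne : (U : Set X.left).Nonempty) :
    ∃ (V : X.left.Opens) (h : V ≤ U), (V : Set X.left).Nonempty ∧
      Etale (X.left.homOfLE h ≫ toQuotient hU) := by
  let := sectionsAction hU
  have := isGaloisGroup_invariants hU hU' hne
  have := module_finite_invariants hU hU' hne
  have := isDedekindDomain_invariants hU hU' hne
  have : Algebra.FinitePresentation (invariants hU) Γ(X.left, U) :=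
    Algebra.FinitePresentation.of_finiteType.1 inferInstance
  have hne' : Nonempty U := hne.to_subtype
  obtain ⟨b, hb, h⟩ := IsGaloisGroup.exists_etale_localizationAway (invariants hU) Γ(X.left, U) H
  have h0 := hU'.isLocalization_basicOpen b
  have : Etale (Spec.map (CommRingCat.ofHom ((algebraMap Γ(X.left, U)
      Γ(X.left, X.left.basicOpen b)).comp (algebraMap (invariants hU) Γ(X.left, U))))) := by
    rw [HasRingHomProperty.Spec_iff (P := @Etale)]
    exact h _
  refine ⟨X.left.basicOpen b, X.left.basicOpen_le b, ?_, ?_⟩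
  · by_contra h
    refine hb ((basicOpen_eq_bot_iff b).1 ?_)
    exact TopologicalSpace.Opens.ext (Set.not_nonempty_iff_eq_empty.1 h)
  · rw [toQuotient, ← Scheme.Opens.toSpecΓ_SpecMap_presheaf_map_assoc, ← Spec.map_comp,
      ← (hU'.basicOpen b).isoSpec_hom]
    have : Etale (Spec.map (CommRingCat.ofHom (invariants hU).val.toRingHom ≫
      X.left.presheaf.map (homOfLE (X.left.basicOpen_le b)).op)) := this
    infer_instance

end

end CurveCovers

/-! ### The quotient as a Galois cover -/

namespace CurveCovers

variable {k : Type u} [Field k] {X : Over (Spec (.of k))} {H : Subgroup (Aut X)}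

section

variable {U : X.left.Opens} (hU : IsStable H U)

theorem toQuotient_appTop (b : invariants hU) :
    (toQuotient hU).appTop ((Scheme.ΓSpecIso (.of (invariants hU))).inv b) =
      U.ι.appLE U ⊤ (by simp) b.1 := by
  have h₁ := congr($(Scheme.Hom.comp_appTop U.toSpecΓ
    (Spec.map (CommRingCat.ofHom (invariants hU).val.toRingHom)))
    ((Scheme.ΓSpecIso (.of (invariants hU))).inv b))
  refine h₁.trans ?_
  rw [Scheme.Opens.toSpecΓ_appTop]
  refine (congrArg ((Scheme.ΓSpecIso Γ(X.left, U)).hom ≫ U.topIso.inv)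
    congr($(Scheme.ΓSpecIso_inv_naturality
      (CommRingCat.ofHom (invariants hU).val.toRingHom)) b).symm).trans ?_
  refine (congrArg U.topIso.inv ((Scheme.ΓSpecIso Γ(X.left, U)).commRingCatIsoToRingEquiv.apply_symm_apply
    b.1)).trans ?_
  rw [Scheme.Opens.ι_appLE]
  rfl

variable {Y : Over (Spec (.of k))} {f : X ⟶ Y} {j : Spec (.of (invariants hU)) ⟶ Y.left}
  [IsOpenImmersion j]

theorem exists_sectionsMap_eq_of_isPullback (hp : IsPullback (toQuotient hU) U.ι j f.left)
    (hS : IsStable H (f.left ⁻¹ᵁ j.opensRange)) (b : Γ(X.left, f.left ⁻¹ᵁ j.opensRange))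
    (hb : ∀ (σ) (hσ : σ ∈ H), sectionsMap σ.hom _ _ (hS σ hσ) b = b) :
    ∃ a, sectionsMap f j.opensRange _ le_rfl a = b := by
  -- The preimage of the chart is only propositionally equal to `U`; a variable `V` allows
  -- substitution.
  suffices h : ∀ (V : X.left.Opens) (hUV : U = V) (hV : V ≤ f.left ⁻¹ᵁ j.opensRange)
      (hS : IsStable H V) (b : Γ(X.left, V))
      (hb : ∀ (σ) (hσ : σ ∈ H), sectionsMap σ.hom _ _ (hS σ hσ) b = b),
      ∃ a, sectionsMap f j.opensRange V hV a = b by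
    refine h _ ?_ le_rfl hS b hb
    have := Scheme.image_preimage_eq_of_isPullback hp Set.univ
    rw [Set.preimage_univ, Set.image_univ, Set.image_univ, Scheme.Opens.range_ι] at this
    exact TopologicalSpace.Opens.ext this
  rintro V rfl hV hS b hb
  -- The sections of `Y` over the range of `j` are the invariant ring, so `b` itself gives `a`.
  obtain ⟨a, ha⟩ : ∃ a, j.appLE j.opensRange ⊤ (by simp) a =
      (Scheme.ΓSpecIso (.of (invariants hU))).inv ⟨b, hb⟩ := by
    suffices h : ∀ (W : Y.left.Opens) (_ : j ''ᵁ ⊤ = W) (e : ⊤ ≤ j ⁻¹ᵁ W),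
        Function.Surjective (j.appLE W ⊤ e) from
      h _ j.image_top_eq_opensRange (by simp) _
    rintro W rfl e
    rw [← Scheme.Hom.appIso_hom']
    exact (j.appIso ⊤).commRingCatIsoToRingEquiv.surjective
  refine ⟨a, ?_⟩
  have hinj : Function.Injective (U.ι.appLE U ⊤ (by simp)) := by
    rw [Scheme.Opens.ι_appLE]
    exact U.topIso.commRingCatIsoToRingEquiv.symm.injective
  refine hinj ((congr($(Scheme.Hom.appLE_comp_appLE U.ι f.left j.opensRange U ⊤ hV (by simp)) a)).trans ?_)
  simp only [← hp.w]
  refine (congr($(Scheme.Hom.appLE_comp_appLE (toQuotient hU) j j.opensRange ⊤ ⊤ (by simp) (by simp)) a)).symm.trans ?_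
  refine (congrArg ((toQuotient hU).appLE ⊤ ⊤ _) ha).trans ?_
  exact congr($(Scheme.Hom.appLE_eq_app (toQuotient hU) (U := ⊤)) _).trans
    (toQuotient_appTop hU ⟨b, hb⟩)

end

theorem isGaloisGroup_of_exists [IsIntegral X.left] [IsSeparated X.hom] {Y : Over (Spec (.of k))}
    {f : X ⟶ Y} (hH : H ≤ autOver f) {W : Y.left.Opens} (hW : IsAffineOpen (f.left ⁻¹ᵁ W))
    (hne : ((f.left ⁻¹ᵁ W : X.left.Opens) : Set X.left).Nonempty)
    (h : ∀ b : Γ(X.left, f.left ⁻¹ᵁ W),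
      (∀ (σ) (hσ : σ ∈ H), sectionsMap σ.hom _ _ (isStable_preimage f hH W σ hσ) b = b) →
      ∃ a, sectionsMap f W _ le_rfl a = b) :
    letI := sectionsAlgebraOfHom f W
    letI := sectionsAction (isStable_preimage f hH W)
    IsGaloisGroup H Γ(Y.left, W) Γ(X.left, f.left ⁻¹ᵁ W) := by
  let := sectionsAlgebraOfHom f W
  let := sectionsAction (isStable_preimage f hH W)
  exact ⟨sectionsAction_faithfulSMul (isStable_preimage f hH W) hW hne,
    sectionsAction_smulCommClass_of_le_autOver f W hH, ⟨fun b hb ↦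
    h b ((sectionsAction_forall_smul_eq_iff (isStable_preimage f hH W) b).1 hb)⟩⟩

/-- An element of `Aut(X/Y)` acts on the sections over `W` by an algebra automorphism, which comes
from `H` by Galois theory; morphisms agreeing on these sections are equal. -/
theorem autOver_eq_of_isGaloisGroup [IsIntegral X.left] [IsSeparated X.hom] [Finite H]
    {Y : Over (Spec (.of k))} [IsIntegral Y.left]
    {f : X ⟶ Y} [IsDominant f.left] [IsAffineHom f.left] (hH : H ≤ autOver f) {W : Y.left.Opens} (hW : IsAffineOpen (f.left ⁻¹ᵁ W))
    (hne : ((f.left ⁻¹ᵁ W : X.left.Opens) : Set X.left).Nonempty)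
    (h : letI := sectionsAlgebraOfHom f W
      letI := sectionsAction (isStable_preimage f hH W)
      IsGaloisGroup H Γ(Y.left, W) Γ(X.left, f.left ⁻¹ᵁ W)) : autOver f = H := by
  refine le_antisymm (fun σ hσ ↦ ?_) hH
  let := sectionsAlgebraOfHom f W
  let := sectionsAction (isStable_preimage f hH W)
  let := sectionsAction (isStable_preimage f (le_refl (autOver f)) W)
  have := sectionsAction_smulCommClass_of_le_autOver f W (le_refl (autOver f))
  have := faithfulSMul_sections f W
  have hne' : Nonempty (f.left ⁻¹ᵁ W : X.left.Opens) := hne.to_subtype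
  obtain ⟨τ, hτ⟩ := (IsGaloisGroup.mulEquivAlgEquiv H Γ(Y.left, W) Γ(X.left, f.left ⁻¹ᵁ W)).surjective
    (MulSemiringAction.toAlgEquiv Γ(Y.left, W) Γ(X.left, f.left ⁻¹ᵁ W) (⟨σ, hσ⟩ : autOver f))
  have hστ := hom_ext_of_appLE_eq hW hW hne (isStable_preimage f hH W _ (τ⁻¹).2)
    (isStable_preimage f (le_refl (autOver f)) W _ (inv_mem hσ)) (by ext b; exact congr($hτ b))
  have : τ.1 = σ := inv_injective (Iso.ext hστ)
  exact this ▸ τ.2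

theorem card_eq_degree_of_isGaloisGroup [IsIntegral X.left] [Finite H]
    {Y : Over (Spec (.of k))} [IsIntegral Y.left]
    {f : X ⟶ Y} [IsDominant f.left] [IsAffineHom f.left] (hH : H ≤ autOver f) {W : Y.left.Opens}
    (hW : IsAffineOpen W) (hne : ((f.left ⁻¹ᵁ W : X.left.Opens) : Set X.left).Nonempty)
    (h : letI := sectionsAlgebraOfHom f W
      letI := sectionsAction (isStable_preimage f hH W)
      IsGaloisGroup H Γ(Y.left, W) Γ(X.left, f.left ⁻¹ᵁ W)) : Nat.card H = degree f.left := by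
  let := sectionsAlgebraOfHom f W
  let := sectionsAction (isStable_preimage f hH W)
  have := faithfulSMul_sections f W
  have hne₁ : Nonempty (f.left ⁻¹ᵁ W : X.left.Opens) := hne.to_subtype
  have hne₂ : (W : Set Y.left).Nonempty := hne.elim fun x hx ↦ ⟨_, hx⟩
  have hne₃ : Nonempty W := hne₂.to_subtype
  rw [degree_eq_finrank_sections f W hW hne₂]
  exact IsGaloisGroup.card_eq_finrank_of_isDomain Γ(Y.left, W) Γ(X.left, f.left ⁻¹ᵁ W) H


/-- Every finite group of automorphisms of a curve is the Galois group of a cover. -/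
theorem exists_galoisCover [IsAlgClosed k] (X : Over (Spec (.of k))) [IsSmoothProperCurve X]
    {G : Type*} [Group G] (H : Subgroup (Aut X)) [Finite H] (e : Nonempty (H ≃* G)) :
    ∃ c : GaloisCover X G, autOver c.map = H := by
  obtain ⟨U₁, U₂, h₁, h₂, Y, f, j₁, j₂, hj₁, hj₂, hU₁, hU₂, hη, hU, ⟨τ₁, ht₁, hc₁⟩, ⟨τ₂, ht₂, hc₂⟩, hj,
    hp₁, hp₂, hy₁, hy₂⟩ := exists_quotient X H
  have hne₁ : (U₁ : Set X.left).Nonempty := ⟨_, hη.1⟩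
  have hne₂ : (U₂ : Set X.left).Nonempty := ⟨_, hη.2⟩
  have := isDedekindDomain_invariants h₁ hU₁ hne₁
  have := isDedekindDomain_invariants h₂ hU₂ hne₂
  have := finiteType_invariants h₁ hU₁ hne₁
  have := finiteType_invariants h₂ hU₂ hne₂
  have : HasAffineProperty @IsFinite.{u} (affineAnd RingHom.Finite) :=
    (HasAffineProperty.affineAnd_iff _ RingHom.finite_respectsIso
      RingHom.finite_localizationPreserves.away RingHom.finite_ofLocalizationSpan).2
        isFinite_iff
  have : IsZariskiLocalAtTarget @IsFinite.{u} :=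
    HasAffineProperty.instIsZariskiLocalAtTarget (Q := affineAnd RingHom.Finite)
  have hfin : IsFinite f.left := of_pair_target j₁ j₂ hj hp₁ hp₂ (isFinite_toQuotient h₁ hU₁ hne₁)
    (isFinite_toQuotient h₂ hU₂ hne₂)
  have hsurj : Surjective f.left := of_pair_target j₁ j₂ hj hp₁ hp₂
    (surjective_toQuotient h₁ hU₁ hne₁) (surjective_toQuotient h₂ hU₂ hne₂)
  have hred : IsReduced Y.left := isReduced_of_pair j₁ j₂ hj
  have hirr : IrreducibleSpace Y.left := irreducibleSpace_of_surjective f.left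
  have hint : IsIntegral Y.left := isIntegral_of_irreducibleSpace_of_isReduced _
  have hsm : SmoothOfRelativeDimension 1 Y.hom := by
    have : IsZariskiLocalAtSource (@SmoothOfRelativeDimension.{u} 1) :=
      HasRingHomProperty.instIsZariskiLocalAtSource
        (Q := RingHom.Locally (RingHom.IsStandardSmoothOfRelativeDimension 1))
    -- Each `τᵢ` is a nonconstant invariant, so neither chart is the spectrum of `k`.
    refine of_pair_source j₁ j₂ hj (P := @SmoothOfRelativeDimension 1) ?_ ?_
    · rw [hy₁]
      refine smoothOfRelativeDimension_one_SpecMap k _ fun h ↦ ?_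
      obtain ⟨c, hc⟩ := h ⟨τ₁, ht₁⟩
      exact hc₁ c congr(($hc).1)
    · rw [hy₂]
      refine smoothOfRelativeDimension_one_SpecMap k _ fun h ↦ ?_
      obtain ⟨c, hc⟩ := h ⟨τ₂, ht₂⟩
      exact hc₂ c congr(($hc).1)
  have hY : IsSmoothProperCurve Y := by
    have : Smooth Y.hom := SmoothOfRelativeDimension.smooth 1 Y.hom
    have : IsProper (f.left ≫ Y.hom) := by
      rw [Over.w f]
      infer_instance
    exact ⟨hint, .of_comp_of_surjective f.left Y.hom, hsm⟩
  have het : GenericallyEtale f.left := by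
    obtain ⟨V, hV, hne, _⟩ := exists_etale_toQuotient h₁ hU₁ hne₁
    refine ⟨V, hne, ?_⟩
    have : V.ι ≫ f.left = (X.left.homOfLE hV ≫ toQuotient h₁) ≫ j₁ := by
      rw [Category.assoc, hp₁.w, X.left.homOfLE_ι_assoc]
    rw [this]
    infer_instance
  have hH : H ≤ autOver f := by
    intro σ hσ
    -- On each chart `f` is given by invariant sections, so composing with `σ` changes nothing.
    have key {U : X.left.Opens} (hU : IsStable H U)
        (j : Spec (.of (invariants hU)) ⟶ Y.left)
        (hp : toQuotient hU ≫ j = U.ι ≫ f.left) :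
        U.ι ≫ σ.hom.left ≫ f.left = U.ι ≫ f.left := by
      rw [← hp, ← resLE_toQuotient hU σ hσ, Category.assoc, hp, Scheme.Hom.resLE_comp_ι_assoc]
    refine Over.OverMorphism.ext (Scheme.hom_ext_of_forall _ _ fun z ↦ ?_)
    obtain hz | hz := (hU.ge (Set.mem_univ z) : z ∈ U₁ ⊔ U₂)
    · exact ⟨U₁, hz, key h₁ j₁ hp₁.w⟩
    · exact ⟨U₂, hz, key h₂ j₂ hp₂.w⟩
  have hdom : IsDominant f.left := inferInstance
  -- One nonempty affine chart determines both the automorphism group and the degree.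
  have hW := isAffineOpen_opensRange j₁
  have hne : ((f.left ⁻¹ᵁ j₁.opensRange : X.left.Opens) : Set X.left).Nonempty := by
    obtain ⟨x, hx⟩ := hne₁
    exact ⟨x, toQuotient h₁ ⟨x, hx⟩, congr($hp₁.w ⟨x, hx⟩)⟩
  have hgal := isGaloisGroup_of_exists hH (hW.preimage f.left) hne
    (exists_sectionsMap_eq_of_isPullback h₁ hp₁ (isStable_preimage f hH j₁.opensRange))
  have hau := autOver_eq_of_isGaloisGroup hH (hW.preimage f.left) hne hgal
  have hdeg := card_eq_degree_of_isGaloisGroup hH hW hne hgal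
  exact ⟨⟨Y, hY, f, ⟨hfin, het⟩, by rw [hau, hdeg], by rwa [hau]⟩, hau⟩

end CurveCovers

/-! ### The correspondence between covers and group actions -/

theorem mainTheorem5 {k : Type u} [Field k] [IsAlgClosed k]
    (X : Over (Spec (.of k))) [CurveCovers.IsSmoothProperCurve X]
    (G : Type*) [Group G] [Finite G] :
    ∃ Φ : CurveCovers.CoverClass X G ≃ CurveCovers.GroupAction X G,
      ∀ c : CurveCovers.GaloisCover X G,
        (Φ (Quotient.mk _ c)).1 = CurveCovers.autOver c.map ∧
        CurveCovers.ramificationLocus c.map.left =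
          CurveCovers.stabilizedLocus (Φ (Quotient.mk _ c)).1 := by
  let φ : CurveCovers.CoverClass X G → CurveCovers.GroupAction X G :=
    Quotient.lift (fun c ↦ ⟨CurveCovers.autOver c.map, c.aut_iso⟩)
      fun c₁ c₂ h ↦ Subtype.ext (CurveCovers.autOver_eq_of_equiv c₁ c₂ h)
  have hφ : Function.Bijective φ := by
    refine ⟨?_, fun ⟨H, ⟨e⟩⟩ ↦ ?_⟩
    · rintro ⟨c₁⟩ ⟨c₂⟩ h
      exact Quotient.sound (CurveCovers.equiv_of_autOver_eq c₁ c₂ congr(($h).1))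
    · have : Finite H := .of_equiv G e.symm.toEquiv
      obtain ⟨c, hc⟩ := CurveCovers.exists_galoisCover X H ⟨e⟩
      exact ⟨Quotient.mk _ c, Subtype.ext hc⟩
  exact ⟨.ofBijective φ hφ, fun c ↦ ⟨rfl, CurveCovers.ramificationLocus_eq_stabilizedLocus c⟩⟩
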